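/- **Setting.** Let $\mathcal B$ be a Boolean algebra (not necessarily unital), $\mathcal L$ a set, $\theta_a:\mathcal B\to\mathcal B$ ($a\in\mathcal L$) Boolean homomorphisms with $\theta_a(\emptyset)=\emptyset$, and $\mathcal I_a$ ($a\in\mathcal L$) ideals of $\mathcal B$ with $\{A: A\subseteq\theta_a(C)\text{ for some }C\in\mathcal B\}\subseteq\mathcal I_a$; that is, $(\mathcal B,\mathcal L,\theta,\mathcal I_\alpha)$ is a generalized Boolean dynamical system. For a finite word $\alpha=\alpha_1\cdots\alpha_n$ in $\mathcal L$ put $\theta_\alpha=\theta_{\alpha_n}\circ\cdots\circ\theta_{\alpha_1}$ ($\theta_\emptyset=\mathrm{id}$), $\mathcal I_\emptyset=\mathcal B$, and $\mathcal I_\alpha=\{A: A\subseteq\theta_{\alpha_2\cdots\alpha_n}(C)\text{ for some }C\in\mathcal I_{\alpha_1}\}$ for $n\ge1$. Let $X_\alpha$ be the space of ultrafilters in $\mathcal I_\alpha$, with the topology generated by the sets $\{F: A\in F\}$, $A\in\mathcal I_\alpha$. **The tight spectrum.** Let $S$ be the inverse semigroup consisting of $0$ and all $(\alpha,A,\beta)$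 with $\alpha,\beta$ finite words and $\emptyset\ne A\in\mathcal I_\alpha\cap\mathcal I_\beta$, where $(\alpha,A,\beta)(\beta\gamma',C,\delta)=(\alpha\gamma',\theta_{\gamma'}(A)\cap C,\delta)$ and $(\alpha,A,\gamma\beta')(\gamma,C,\delta)=(\alpha,A\cap\theta_{\beta'}(C),\delta\beta')$ if the middle entry is nonempty, and all other products are $0$. Let $E(S)$ be its semilattice of idempotents, i.e. $0$ and the elements $(\alpha,A,\alpha)$, ordered by $e\le f\iff ef=e$. A finite $Z\subseteq\{y\in E(S):y\le x\}$ is a cover for $x$ if every $0\ne y\le x$ satisfies $zy\neq0$ for some $z\in Z$. A filter $\xi$ in $E(S)$ is tight if its character $\phi_\xi(e)=[e\in\xi]\in\{0,1\}$ satisfies $\bigvee_{z\in Z}\phi_\xi(z)=\phi_\xi(x)$ for all $x\in E(S)$ and all finite covers $Z$ for $x$. The tight spectrum $\mathsf T$ is the set of tight filters, with the topology of pointwise convergence of characters. The word associated with $\xi$ is the shortest finite or infinite word $\alpha$ such that $\beta$ is an initial segment of $\alpha$ whenever $(\beta,A,\beta)\in\xi$; let $\mathsf T^{(1)}\subseteq\mathsf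 T$ be the set of those $\xi$ whose word has length at least $1$. For $\xi\in\mathsf T^{(1)}$ with word $\alpha$, let $\sigma(\xi)\in\mathsf T$ be the tight filter of all $(\delta,D,\delta)\in E(S)\setminus\{0\}$ for which there is $(\alpha_1\delta,A,\alpha_1\delta)\in\xi$ with $A\subseteq D$. **The boundary path space.** Let $E^0=X_\emptyset$, let $F^0=X_\emptyset\cup\{\emptyset\}$ be its one-point compactification (with $\emptyset$ isolated if $\mathcal B$ is unital), and let $E^1=\{e^a_\eta: a\in\mathcal L,\ \eta\in X_a\}$, with the topology generated by the sets $\{e^a_\eta: A\in\eta\}$, $a\in\mathcal L$, $A\in\mathcal I_a$. Define $d:E^1\to E^0$ and $r:E^1\to F^0$ by $d(e^a_\eta)=\{D\in\mathcal B: A\subseteq D\text{ for some }A\in\eta\}$ and $r(e^a_\eta)=\{A\in\mathcal B:\theta_a(A)\in\eta\}$. Let $F^0_{sce}=F^0\setminus\overline{r(E^1)}$, let $F^0_{fin}$ be the set of $v\in F^0$ having a neighbourhood $V$ with $r^{-1}(V)$ compact, $F^0_{rg}=F^0_{fin}\setminus\overline{F^0_{sce}}$, and $E^0_{sg}=E^0\setminus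 F^0_{rg}$. A path is a finite or infinite sequence of edges $e_1e_2\cdots$ in $E^1$ with $d(e_i)=r(e_{i+1})$ for all $i$ for which $e_{i+1}$ is defined; elements $v\in E^0$ are the paths of length $0$, with $r(v)=d(v)=v$; and $r(e_1e_2\cdots)=r(e_1)$, $d(e_1\cdots e_n)=d(e_n)$. Let $E^*=\bigsqcup_{n\ge0}E^n$ be the space of finite paths, where $E^n\subseteq\prod_{i=1}^nE^1$ ($n\ge1$) has the subspace topology. The boundary path space $\partial E$ is the set of all infinite paths and all finite paths $\mu$ with $d(\mu)\in E^0_{sg}$, with the topology generated by the sets $\mathcal Z(U)\cap\mathcal Z(K)^c$, $U\subseteq E^*$ open and $K\subseteq E^*$ compact, where $\mathcal Z(Y)$ is the set of $\mu\in\partial E$ with $r(\mu)\in Y$ or $\mu_1\cdots\mu_i\in Y$ for some $1\le i\le|\mu|$. The shift $\sigma_E:\partial E\setminus E^0_{sg}\to\partial E$ removes the first edge of a path of length at least $2$ and sends a path $\mu$ of length $1$ to $d(\mu)$. **Theorem.** There exists a homeomorphism $\phi:\mathsf T\to\partial E$ such that $\phi\circ\sigma=\sigma_E\circ\phi|_{\mathsf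 T^{(1)}}$ (in particular, $\phi(\mathsf T^{(1)})\subseteq\partial E\setminus E^0_{sg}$). -/

import Mathlib

open Set Topology

/-! ### Filters -/

/-- `ξ` is a filter in the partially ordered set `(C, le)` with least element `zero`. The set `C` is
given as a subset of an ambient type `P`. -/
structure IsFilterOn {P : Type*} (le : P → P → Prop) (zero : P) (C ξ : Set P) : Prop where
  subset : ξ ⊆ C
  nonempty : ξ.Nonempty
  zero_notMem : zero ∉ ξ
  up : ∀ x ∈ ξ, ∀ y ∈ C, le x y → y ∈ ξ
  down : ∀ x ∈ ξ, ∀ y ∈ ξ, ∃ z ∈ ξ, le z x ∧ le z y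

/-- An ultrafilter is a filter that is not properly contained in any filter. -/
structure IsUltrafilterOn {P : Type*} (le : P → P → Prop) (zero : P) (C ξ : Set P) : Prop where
  filter : IsFilterOn le zero C ξ
  maximal : ∀ η, IsFilterOn le zero C η → ξ ⊆ η → η = ξ

section Prime

variable {B : Type*} [GeneralizedBooleanAlgebra B] {C ξ : Set B}

theorem IsFilterOn.inf_mem (hC : IsLowerSet C) (h : IsFilterOn (· ≤ ·) ⊥ C ξ) {a b : B}
    (ha : a ∈ ξ) (hb : b ∈ ξ) : a ⊓ b ∈ ξ := by
  obtain ⟨z, hz, hza, hzb⟩ := h.down a ha b hb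
  exact h.up z hz _ (hC inf_le_left (h.subset ha)) (le_inf hza hzb)

theorem IsUltrafilterOn.prime (hC : IsLowerSet C) (h : IsUltrafilterOn (· ≤ ·) ⊥ C ξ) {a b : B}
    (hab : a ⊔ b ∈ ξ) : a ∈ ξ ∨ b ∈ ξ := by
  have haC : a ∈ C := hC le_sup_left (h.filter.subset hab)
  have hbC : b ∈ C := hC le_sup_right (h.filter.subset hab)
  by_cases hc : ∃ c ∈ ξ, c ⊓ a = ⊥
  · obtain ⟨c, hcξ, hca⟩ := hc
    right
    refine h.filter.up _ (h.filter.inf_mem hC hcξ hab) b hbC ?_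
    rw [inf_sup_left, hca, bot_sup_eq]
    exact inf_le_right
  · push Not at hc
    left
    have hG : IsFilterOn (· ≤ ·) ⊥ C {y | y ∈ C ∧ ∃ c ∈ ξ, c ⊓ a ≤ y} := by
      refine ⟨fun y hy => hy.1, ⟨a, haC, _, hab, inf_le_right⟩, ?_, ?_, ?_⟩
      · rintro ⟨-, c, hcξ, hca⟩
        exact hc c hcξ (le_bot_iff.1 hca)
      · rintro x ⟨-, c, hcξ, hca⟩ y hy hxy
        exact ⟨hy, c, hcξ, hca.trans hxy⟩
      · rintro x ⟨hx, c, hcξ, hca⟩ y ⟨hy, c', hcξ', hca'⟩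
        refine ⟨x ⊓ y, ⟨hC inf_le_left hx, c ⊓ c', h.filter.inf_mem hC hcξ hcξ', ?_⟩,
          inf_le_left, inf_le_right⟩
        exact le_inf ((inf_le_inf_right a inf_le_left).trans hca)
          ((inf_le_inf_right a inf_le_right).trans hca')
    have hsub : ξ ⊆ {y | y ∈ C ∧ ∃ c ∈ ξ, c ⊓ a ≤ y} :=
      fun y hy => ⟨h.filter.subset hy, y, hy, inf_le_left⟩
    rw [← h.maximal _ hG hsub]
    exact ⟨haC, _, hab, inf_le_right⟩

theorem IsFilterOn.isUltrafilterOn (h : IsFilterOn (· ≤ ·) ⊥ C ξ)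
    (hp : ∀ a b : B, a ⊔ b ∈ ξ → a ∈ ξ ∨ b ∈ ξ) : IsUltrafilterOn (· ≤ ·) ⊥ C ξ := by
  refine ⟨h, fun η hη hsub => Subset.antisymm (fun g hg => ?_) hsub⟩
  obtain ⟨a, ha⟩ := h.nonempty
  have := hp (a ⊓ g) (a \ g) (by rwa [sup_inf_sdiff])
  rcases this with h1 | h1
  · exact h.up _ h1 g (hη.subset hg) inf_le_right
  · obtain ⟨z, hz, hz1, hz2⟩ := hη.down _ (hsub h1) _ hg
    have : z ≤ ⊥ := by
      have h3 : z ≤ (a \ g) ⊓ g := le_inf hz1 hz2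
      rwa [inf_comm, inf_sdiff_self_right] at h3
    exact absurd (le_bot_iff.1 this ▸ hz) hη.zero_notMem

end Prime

/-! ### Generalized Boolean dynamical systems -/

/-- A generalized Boolean dynamical system `(B, L, θ, I)` on a (not necessarily unital) Boolean
algebra `B`: each letter `a : L` acts by a Boolean homomorphism `θ a`, and has an ideal `I a` that
contains every `A ≤ θ a C`. -/
structure GBDS (B L : Type*) [GeneralizedBooleanAlgebra B] where
  θ : L → B → B
  θ_bot : ∀ a, θ a ⊥ = ⊥
  θ_inf : ∀ a A C, θ a (A ⊓ C) = θ a A ⊓ θ a C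
  θ_sup : ∀ a A C, θ a (A ⊔ C) = θ a A ⊔ θ a C
  θ_sdiff : ∀ a A C, θ a (A \ C) = θ a A \ θ a C
  I : L → Order.Ideal B
  range_le : ∀ a A C, A ≤ θ a C → A ∈ I a

namespace GBDS

variable {B L : Type*} [GeneralizedBooleanAlgebra B] (G : GBDS B L)

/-- The action of a word, `θ_{α₁ ⋯ αₙ} = θ_{αₙ} ∘ ⋯ ∘ θ_{α₁}`. -/
def act (α : List L) (A : B) : B := α.foldl (fun C a => G.θ a C) A

/-- The ideal `I_α` of a word: `I_∅ = B`, and `I_{aβ}` consists of all `A ≤ θ_β(C)` with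
`C ∈ I_a`. -/
def ideal : List L → Set B
  | [] => univ
  | a :: β => {A | ∃ C ∈ G.I a, A ≤ G.act β C}

@[simp] theorem act_nil (A : B) : G.act [] A = A := rfl

@[simp] theorem act_cons (a : L) (α : List L) (A : B) :
    G.act (a :: α) A = G.act α (G.θ a A) := rfl

theorem act_append (α β : List L) (A : B) : G.act (α ++ β) A = G.act β (G.act α A) := by
  simp [act, List.foldl_append]

theorem act_inf (α : List L) (A C : B) : G.act α (A ⊓ C) = G.act α A ⊓ G.act α C := by
  induction α generalizing A C with
  | nil => rfl
  | cons a t ih => simp [G.θ_inf, ih]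

theorem act_mono (α : List L) {A C : B} (h : A ≤ C) : G.act α A ≤ G.act α C := by
  rw [← inf_eq_left, ← act_inf, inf_eq_left.2 h]

theorem ideal_lower (α : List L) : IsLowerSet (G.ideal α) := by
  intro A C h hA
  cases α with
  | nil => trivial
  | cons a t =>
    obtain ⟨D, hD, h'⟩ := hA
    exact ⟨D, hD, h.trans h'⟩

theorem act_mem_ideal (α β : List L) {A : B} (h : A ∈ G.ideal α) :
    G.act β A ∈ G.ideal (α ++ β) := by
  cases α with
  | nil =>
    cases β with
    | nil => trivial
    | cons b t => exact ⟨G.θ b A, G.range_le b _ A le_rfl, le_rfl⟩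
  | cons a t =>
    obtain ⟨D, hD, h'⟩ := h
    refine ⟨D, hD, ?_⟩
    change G.act β A ≤ G.act (t ++ β) D
    rw [act_append]
    exact G.act_mono β h'

theorem ideal_cons_subset (a : L) (β : List L) : G.ideal (a :: β) ⊆ G.ideal β := by
  rintro A ⟨D, -, h⟩
  cases β with
  | nil => trivial
  | cons b t => exact ⟨G.θ b D, G.range_le b _ D le_rfl, h⟩

/-! ### The inverse semigroup and its idempotents -/

/-- The underlying set of the inverse semigroup: `0` and the triples `(α, A, β)` with
`∅ ≠ A ∈ I_α ∩ I_β`. -/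
inductive Semi : Type _
  | zero : Semi
  | tri (α : List L) (A : B) (β : List L) (hne : A ≠ ⊥) (hα : A ∈ G.ideal α)
      (hβ : A ∈ G.ideal β) : Semi

variable {G}

open Classical in
/-- The product. If `γ = βγ'` (including `γ = β`), then
`(α, A, β)(γ, C, δ) = (αγ', θ_{γ'}(A) ∩ C, δ)`; if `β = γβ'`, then it is
`(α, A ∩ θ_{β'}(C), δβ')`; a product whose middle entry would be empty is `0`, and so is every
other product. -/
noncomputable def Semi.mul : G.Semi → G.Semi → G.Semi
  | .zero, _ => .zero
  | .tri .., .zero => .zero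
  | .tri α A β _ hα _, .tri γ C δ _ _ hδ =>
    if β <+: γ then
      if h : G.act (γ.drop β.length) A ⊓ C ≠ ⊥ then
        .tri (α ++ γ.drop β.length) (G.act (γ.drop β.length) A ⊓ C) δ h
          (G.ideal_lower _ inf_le_left (G.act_mem_ideal _ _ hα))
          (G.ideal_lower _ inf_le_right hδ)
      else .zero
    else if γ <+: β then
      if h : A ⊓ G.act (β.drop γ.length) C ≠ ⊥ then
        .tri α (A ⊓ G.act (β.drop γ.length) C) (δ ++ β.drop γ.length) h
          (G.ideal_lower _ inf_le_left hα)
          (G.ideal_lower _ inf_le_right (G.act_mem_ideal _ _ hδ))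
      else .zero
    else .zero

noncomputable instance : Mul G.Semi := ⟨Semi.mul⟩

variable (G)

/-- The idempotents `E(S)`. -/
def idem : Set G.Semi := {e | e * e = e}

variable {G}

/-- The order of the semilattice `E(S)`. -/
def Semi.le (e f : G.Semi) : Prop := e * f = e

/-- `Z` is a cover for `x` in `E(S)`. -/
def IsCover (Z : Set G.Semi) (x : G.Semi) : Prop :=
  (∀ z ∈ Z, z ∈ G.idem ∧ z.le x) ∧ ∀ y ∈ G.idem, y.le x → y ≠ .zero → ∃ z ∈ Z, z * y ≠ .zero

open Classical in
/-- The character `e ↦ [e ∈ ξ]` of a filter `ξ` in `E(S)`. -/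
noncomputable def charOf (ξ : Set G.Semi) (e : G.Semi) : Bool := decide (e ∈ ξ)

/-- A tight filter in `E(S)`: a filter whose character `φ` satisfies `⋁_{z ∈ Z} φ(z) = φ(x)` for
every `x ∈ E(S)` and every finite cover `Z` for `x`. -/
structure IsTight (ξ : Set G.Semi) : Prop where
  filter : IsFilterOn Semi.le Semi.zero G.idem ξ
  tight : ∀ x ∈ G.idem, ∀ Z : Finset G.Semi, IsCover (Z : Set G.Semi) x →
    Z.sup (charOf ξ) = charOf ξ x

variable (G)

/-- The tight spectrum `T`, as the set of tight filters in `E(S)`. -/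
def TightSpectrum : Type _ := {ξ : Set G.Semi // IsTight ξ}

/-- The topology of `T` is that of pointwise convergence of characters on `E(S)`. -/
noncomputable instance : TopologicalSpace G.TightSpectrum :=
  TopologicalSpace.induced (fun ξ (e : G.idem) => charOf ξ.1 e.1) inferInstance

variable {G}

/-- The component of `ξ` at the word `β`: all `A ∈ I_β` with `(β, A, β) ∈ ξ`. If `α` is the word
associated with `ξ` and `β = α₁ ⋯ αₙ`, this is `ξₙ`. -/
def component (ξ : Set G.Semi) (β : List L) : Set B :=
  {A | ∃ (hne : A ≠ ⊥) (hA : A ∈ G.ideal β), Semi.tri β A β hne hA hA ∈ ξ}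

variable (G)

/-- `T⁽ⁿ⁾`: the tight filters whose associated word has length at least `n`, that is, which contain
some `(β, A, β)` with `|β| ≥ n`. -/
def tightGE (n : ℕ) : Set G.TightSpectrum :=
  {ξ | ∃ β : List L, n ≤ β.length ∧ (component ξ.1 β).Nonempty}

/-- The cutting map `h_{[α]β}(F) = ↑F` on filters `F` in `I_{αβ}`: the set of all elements of `I_β`
that contain an element of `F`. -/
def cut (β : List L) (F : Set B) : Set B := {D | D ∈ G.ideal β ∧ ∃ A ∈ F, A ≤ D}

variable {G}

/-- The filter `σ(ξ) = H_{[a]γ}(ξ)`, where `aγ` is the word associated with `ξ`: its component at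
`γ₁ ⋯ γₙ` is `h_{[a]γ₁⋯γₙ}(ξₙ₊₁)`. -/
def shiftSet (ξ : Set G.Semi) : Set G.Semi :=
  {e | ∃ (a : L) (δ : List L) (D : B) (hne : D ≠ ⊥) (hD : D ∈ G.ideal δ),
    e = Semi.tri δ D δ hne hD hD ∧ D ∈ G.cut δ (component ξ (a :: δ))}

/-! Facts on the idempotents, needed to see that `σ(ξ)` is a tight filter. -/

theorem Semi.tri_mul_zero {α β : List L} {A : B} (h1 h2 h3) :
    (Semi.tri α A β h1 h2 h3 : G.Semi) * .zero = .zero := rfl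

theorem Semi.zero_mul (s : G.Semi) : Semi.zero * s = Semi.zero := by cases s <;> rfl

theorem Semi.mul_zero (s : G.Semi) : s * Semi.zero = Semi.zero := by cases s <;> rfl

theorem Semi.zero_mem_idem : (Semi.zero : G.Semi) ∈ G.idem := rfl

theorem Semi.zero_le (s : G.Semi) : Semi.le Semi.zero s := Semi.zero_mul s

theorem Semi.mul_ne_zero_right (α ε : List L) (A C : B) (h1 h2 h3 k1 k2 k3) :
    (Semi.tri α A α h1 h2 h3 : G.Semi) * Semi.tri (α ++ ε) C (α ++ ε) k1 k2 k3 ≠ .zero ↔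
      G.act ε A ⊓ C ≠ ⊥ := by
  change Semi.mul _ _ ≠ _ ↔ _
  simp only [Semi.mul]
  rw [if_pos (List.prefix_append α ε)]
  split_ifs with h <;> simp only [List.drop_left] at h <;> simp [h]

theorem Semi.mul_ne_zero_left (α ε : List L) (A C : B) (h1 h2 h3 k1 k2 k3) :
    (Semi.tri (α ++ ε) A (α ++ ε) h1 h2 h3 : G.Semi) * Semi.tri α C α k1 k2 k3 ≠ .zero ↔
      A ⊓ G.act ε C ≠ ⊥ := by
  cases ε with
  | nil =>
    have := Semi.mul_ne_zero_right (G := G) (α ++ []) [] A C h1 h2 h3 k1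
      (by simpa using k2) (by simpa using k3)
    simpa using this
  | cons b t =>
    change Semi.mul _ _ ≠ _ ↔ _
    simp only [Semi.mul]
    rw [if_neg (fun h => by have := h.length_le; simp at this), if_pos (List.prefix_append _ _)]
    split_ifs with h <;> rw [List.drop_left] at h <;> simp [- act_cons, h]

theorem Semi.comparable_of_mul_ne_zero {α β γ δ : List L} {A C : B} {h1 h2 h3 k1 k2 k3}
    (h : (Semi.tri α A β h1 h2 h3 : G.Semi) * Semi.tri γ C δ k1 k2 k3 ≠ .zero) :
    β <+: γ ∨ γ <+: β := by
  change Semi.mul _ _ ≠ _ at h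
  simp only [Semi.mul] at h
  split_ifs at h <;> simp_all

theorem Semi.le_tri_iff {α β : List L} {A C : B} {h1 h2 h3 k1 k2 k3} :
    Semi.le (Semi.tri α A α h1 h2 h3 : G.Semi) (Semi.tri β C β k1 k2 k3) ↔
      ∃ ε, α = β ++ ε ∧ A ≤ G.act ε C := by
  change Semi.mul _ _ = _ ↔ _
  simp only [Semi.mul]
  constructor
  · intro h
    split_ifs at h with ha hb hc hd
    · obtain ⟨ε, rfl⟩ := ha
      simp only [List.drop_left, Semi.tri.injEq] at h
      obtain ⟨h0, h, -⟩ := h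
      obtain rfl : ε = [] := List.append_right_eq_self.1 h0
      refine ⟨[], by simp, ?_⟩
      simp only [act_nil] at h ⊢
      exact inf_eq_left.1 h
    · obtain ⟨ε, rfl⟩ := hc
      simp only [List.drop_left, Semi.tri.injEq, true_and, and_true] at h
      exact ⟨ε, rfl, inf_eq_left.1 h⟩
  · rintro ⟨ε, rfl, h⟩
    cases ε with
    | nil =>
      simp only [act_nil] at h
      have e : A ⊓ C = A := inf_eq_left.2 h
      simp [e, h1]
    | cons b t =>
      rw [if_neg (fun h => by have := h.length_le; simp at this),
        if_pos (List.prefix_append _ _)]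
      have e : A ⊓ G.act (b :: t) C = A := inf_eq_left.2 h
      simp only [List.drop_left, e, ne_eq, h1, not_false_eq_true, dite_true]

theorem Semi.tri_mem_idem {α : List L} {A : B} (h1 h2 h3) :
    (Semi.tri α A α h1 h2 h3 : G.Semi) ∈ G.idem :=
  (Semi.le_tri_iff (G := G)).2 ⟨[], by simp, le_rfl⟩

theorem Semi.eq_of_mem_idem {e : G.Semi} (he : e ∈ G.idem) (h0 : e ≠ .zero) :
    ∃ (α : List L) (A : B) (hne : A ≠ ⊥) (hA : A ∈ G.ideal α),
      e = Semi.tri α A α hne hA hA := by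
  cases e with
  | zero => exact absurd rfl h0
  | tri α A β h1 h2 h3 =>
    suffices α = β by subst this; exact ⟨α, A, h1, h2, rfl⟩
    change Semi.mul _ _ = _ at he
    simp only [Semi.mul] at he
    split_ifs at he with ha hb hc hd
    · obtain ⟨ε, rfl⟩ := ha
      simp only [List.drop_left, Semi.tri.injEq] at he
      obtain rfl : ε = [] := List.append_right_eq_self.1 he.1
      simp
    · obtain ⟨ε, rfl⟩ := hc
      simp only [List.drop_left, Semi.tri.injEq] at he
      obtain rfl : ε = [] := List.append_right_eq_self.1 he.2.2
      simp

theorem exists_tri_of_mem {ξ : Set G.Semi} (hξ : IsFilterOn Semi.le Semi.zero G.idem ξ)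
    {e : G.Semi} (he : e ∈ ξ) : ∃ (α : List L) (A : B) (hne : A ≠ ⊥) (hA : A ∈ G.ideal α),
      e = Semi.tri α A α hne hA hA :=
  Semi.eq_of_mem_idem (hξ.subset he) (fun h => hξ.zero_notMem (h ▸ he))

theorem shiftSet_isFilterOn {ξ : Set G.Semi} (hξ : IsFilterOn Semi.le Semi.zero G.idem ξ)
    (h1 : ∃ β : List L, 1 ≤ β.length ∧ (component ξ β).Nonempty) :
    IsFilterOn Semi.le Semi.zero G.idem (shiftSet ξ) := by
  refine ⟨?_, ?_, ?_, ?_, ?_⟩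
  · rintro e ⟨a, δ, D, hne, hD, rfl, -⟩
    exact Semi.tri_mem_idem _ _ _
  · obtain ⟨β, hβ, A, hne, hA, hm⟩ := h1
    cases β with
    | nil => simp at hβ
    | cons a δ =>
      exact ⟨_, a, δ, A, hne, G.ideal_cons_subset _ _ hA, rfl, G.ideal_cons_subset _ _ hA,
        A, ⟨hne, hA, hm⟩, le_rfl⟩
  · rintro ⟨a, δ, D, hne, hD, h, -⟩
    cases h
  · rintro e ⟨a, δ, D, hne, hD, rfl, -, A, ⟨hAne, hA, hm⟩, hAD⟩ y hy hle
    have hy0 : y ≠ .zero := by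
      rintro rfl
      have : (Semi.tri δ D δ hne hD hD : G.Semi) * .zero = _ := hle
      rw [Semi.tri_mul_zero] at this
      cases this
    obtain ⟨β, C, hCne, hC, rfl⟩ := Semi.eq_of_mem_idem hy hy0
    obtain ⟨ε, rfl, hDC⟩ := Semi.le_tri_iff.1 hle
    obtain ⟨K, hK, hAK⟩ := hA
    have hA' : A ≤ G.act ε (C ⊓ G.act β K) := by
      rw [act_inf, ← act_append]
      exact le_inf (hAD.trans hDC) hAK
    have hne' : C ⊓ G.act β K ≠ ⊥ := by
      intro h
      rw [h] at hA'
      apply hAne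
      have hb : G.act ε (⊥ : B) = ⊥ := by
        clear * -
        induction ε with
        | nil => rfl
        | cons b t ih => rw [act_cons, G.θ_bot, ih]
      rw [hb] at hA'
      exact le_bot_iff.1 hA'
    have hmem : C ⊓ G.act β K ∈ G.ideal (a :: β) := ⟨K, hK, inf_le_right⟩
    refine ⟨a, β, C, hCne, hC, rfl, hC, C ⊓ G.act β K, ⟨hne', hmem, ?_⟩, inf_le_left⟩
    exact hξ.up _ hm _ (Semi.tri_mem_idem _ _ _) (Semi.le_tri_iff.2 ⟨ε, rfl, hA'⟩)
  · rintro e ⟨a, δ, D, hne, hD, rfl, -, A, ⟨hAne, hA, hm⟩, hAD⟩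
      e' ⟨a', δ', D', hne', hD', rfl, -, A', ⟨hAne', hA', hm'⟩, hAD'⟩
    obtain ⟨z, hz, hz1, hz2⟩ := hξ.down _ hm _ hm'
    obtain ⟨ζ, C, hCne, hC, rfl⟩ := exists_tri_of_mem hξ hz
    obtain ⟨ε, rfl, hCA⟩ := Semi.le_tri_iff.1 hz1
    obtain ⟨ε', hε', hCA'⟩ := Semi.le_tri_iff.1 hz2
    have hC' : C ∈ G.ideal (δ ++ ε) := G.ideal_cons_subset a _ hC
    simp only [List.cons_append, List.cons.injEq] at hε'
    refine ⟨Semi.tri (δ ++ ε) C (δ ++ ε) hCne hC' hC', ⟨a, _, C, hCne, hC', rfl, hC', C,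
      ⟨hCne, hC, hz⟩, le_rfl⟩, Semi.le_tri_iff.2 ⟨ε, rfl, hCA.trans (G.act_mono _ hAD)⟩,
      Semi.le_tri_iff.2 ⟨ε', hε'.2, hCA'.trans (G.act_mono _ hAD')⟩⟩

theorem charOf_eq_true {ξ : Set G.Semi} {e : G.Semi} : charOf ξ e = true ↔ e ∈ ξ := by
  simp [charOf]

theorem sup_charOf {ξ : Set G.Semi} {Z : Finset G.Semi} :
    Z.sup (charOf ξ) = true ↔ ∃ z ∈ Z, z ∈ ξ := by
  classical
  induction Z using Finset.induction_on with
  | empty => simp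
  | insert a s _ ih =>
    rw [Finset.sup_insert]
    have : ∀ x y : Bool, x ⊔ y = true ↔ x = true ∨ y = true := by decide
    rw [this, ih, charOf_eq_true]
    simp

theorem shiftSet_isTight {ξ : Set G.Semi} (hξ : IsTight ξ)
    (h1 : ∃ β : List L, 1 ≤ β.length ∧ (component ξ β).Nonempty) : IsTight (shiftSet ξ) := by
  classical
  have hF := shiftSet_isFilterOn hξ.filter h1
  refine ⟨hF, fun x hx Z hZ => ?_⟩
  rw [Bool.eq_iff_iff, sup_charOf, charOf_eq_true]
  constructor
  · rintro ⟨z, hz, hzs⟩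
    exact hF.up z hzs x hx (hZ.1 z hz).2
  rintro ⟨a, δ, D, hne, hD, rfl, -, A, ⟨hAne, hA, hm⟩, hAD⟩
  have key : ∀ z ∈ Z, ∃ w ∈ G.idem, Semi.le w (Semi.tri (a :: δ) A (a :: δ) hAne hA hA) ∧
      (w ∈ ξ → z ∈ shiftSet ξ) ∧ ∀ (κ : List L) (C : B) (c1 c2 c3),
        C ≤ G.act κ A → z * Semi.tri (δ ++ κ) C (δ ++ κ) c1 c3 c3 ≠ .zero →
        w * Semi.tri (a :: (δ ++ κ)) C (a :: (δ ++ κ)) c1 c2 c2 ≠ .zero := by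
    intro z hz
    by_cases hz0 : z = .zero
    · subst hz0
      refine ⟨.zero, Semi.zero_mem_idem, Semi.zero_le _,
        fun h => absurd h hξ.filter.zero_notMem, ?_⟩
      intro κ C c1 c2 c3 _ h
      exact absurd (Semi.zero_mul _) h
    obtain ⟨ω, F, hFne, hFI, rfl⟩ := Semi.eq_of_mem_idem (hZ.1 z hz).1 hz0
    obtain ⟨ζ, rfl, hFD⟩ := Semi.le_tri_iff.1 (hZ.1 _ hz).2
    have hI : F ⊓ G.act ζ A ∈ G.ideal (a :: (δ ++ ζ)) :=
      G.ideal_lower _ inf_le_right (G.act_mem_ideal (a :: δ) ζ hA)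
    have nz : ∀ (κ : List L) (C : B) (c1 c3), C ≤ G.act κ A →
        (Semi.tri (δ ++ ζ) F (δ ++ ζ) hFne hFI hFI : G.Semi) *
          Semi.tri (δ ++ κ) C (δ ++ κ) c1 c3 c3 ≠ .zero →
        (∃ κ', κ = ζ ++ κ' ∧ G.act κ' (F ⊓ G.act ζ A) ⊓ C ≠ ⊥) ∨
          ∃ ζ', ζ = κ ++ ζ' ∧ (F ⊓ G.act ζ A) ⊓ G.act ζ' C ≠ ⊥ := by
      intro κ C c1 c3 hCA h
      rcases Semi.comparable_of_mul_ne_zero h with hp | hp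
      · rw [List.prefix_append_right_inj] at hp
        obtain ⟨κ', rfl⟩ := hp
        left
        refine ⟨κ', rfl, ?_⟩
        have c3' : C ∈ G.ideal ((δ ++ ζ) ++ κ') := by rwa [List.append_assoc]
        have h' := (Semi.mul_ne_zero_right (G := G) (δ ++ ζ) κ' F C hFne hFI hFI c1 c3' c3').1
          (by simpa only [List.append_assoc] using h)
        rw [act_inf, ← act_append, inf_assoc, inf_eq_right.2 hCA]
        exact h'
      · rw [List.prefix_append_right_inj] at hp
        obtain ⟨ζ', rfl⟩ := hp
        right
        refine ⟨ζ', rfl, ?_⟩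
        have hFI' : F ∈ G.ideal ((δ ++ κ) ++ ζ') := by rwa [List.append_assoc]
        have h' := (Semi.mul_ne_zero_left (G := G) (δ ++ κ) ζ' F C hFne hFI' hFI' c1 c3 c3).1
          (by simpa only [List.append_assoc] using h)
        rw [act_append, inf_assoc, inf_eq_right.2 (G.act_mono ζ' hCA)]
        exact h'
    by_cases hb : F ⊓ G.act ζ A = ⊥
    · refine ⟨.zero, Semi.zero_mem_idem, Semi.zero_le _,
        fun h => absurd h hξ.filter.zero_notMem, ?_⟩
      intro κ C c1 c2 c3 hCA h
      exfalso
      have hbot : ∀ ε : List L, G.act ε (⊥ : B) = ⊥ := by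
        intro ε
        induction ε with
        | nil => rfl
        | cons b t ih => rw [act_cons, G.θ_bot, ih]
      rcases nz κ C c1 c3 hCA h with ⟨κ', -, h'⟩ | ⟨ζ', -, h'⟩
      · rw [hb, hbot] at h'
        simp at h'
      · rw [hb] at h'
        simp at h'
    · refine ⟨Semi.tri (a :: (δ ++ ζ)) (F ⊓ G.act ζ A) (a :: (δ ++ ζ)) hb hI hI,
        Semi.tri_mem_idem _ _ _, Semi.le_tri_iff.2 ⟨ζ, rfl, inf_le_right⟩, ?_, ?_⟩
      · intro hw
        exact ⟨a, δ ++ ζ, F, hFne, hFI, rfl, hFI, _, ⟨hb, hI, hw⟩, inf_le_left⟩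
      · intro κ C c1 c2 c3 hCA h
        rcases nz κ C c1 c3 hCA h with ⟨κ', rfl, h'⟩ | ⟨ζ', rfl, h'⟩
        · have c2' : C ∈ G.ideal ((a :: (δ ++ ζ)) ++ κ') := by
            rwa [List.cons_append, List.append_assoc]
          have := (Semi.mul_ne_zero_right (G := G) (a :: (δ ++ ζ)) κ' _ C hb hI hI c1 c2' c2').2 h'
          simpa only [List.cons_append, List.append_assoc] using this
        · have hI' : F ⊓ G.act (κ ++ ζ') A ∈ G.ideal ((a :: (δ ++ κ)) ++ ζ') := by
            rwa [List.cons_append, List.append_assoc]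
          have := (Semi.mul_ne_zero_left (G := G) (a :: (δ ++ κ)) ζ' _ C hb hI' hI' c1 c2 c2).2 h'
          simpa only [List.cons_append, List.append_assoc] using this
  choose! w hw1 hw2 hw3 hw4 using key
  have hcov : IsCover ((Z.image w : Finset G.Semi) : Set G.Semi)
      (Semi.tri (a :: δ) A (a :: δ) hAne hA hA) := by
    refine ⟨?_, ?_⟩
    · intro v hv
      obtain ⟨z, hz, rfl⟩ := Finset.mem_image.1 (Finset.mem_coe.1 hv)
      exact ⟨hw1 z hz, hw2 z hz⟩
    · intro q hq hqle hq0
      obtain ⟨ω, C, hCne, hC, rfl⟩ := Semi.eq_of_mem_idem hq hq0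
      obtain ⟨κ, rfl, hCA⟩ := Semi.le_tri_iff.1 hqle
      have hC' : C ∈ G.ideal (δ ++ κ) := G.ideal_cons_subset a _ hC
      obtain ⟨z, hz, hzq⟩ := hZ.2 (Semi.tri (δ ++ κ) C (δ ++ κ) hCne hC' hC')
        (Semi.tri_mem_idem _ _ _)
        (Semi.le_tri_iff.2 ⟨κ, rfl, hCA.trans (G.act_mono _ hAD)⟩) (by simp)
      exact ⟨w z, Finset.mem_coe.2 (Finset.mem_image_of_mem w hz), hw4 z hz κ C hCne hC hC' hCA hzq⟩
  have := hξ.tight _ (Semi.tri_mem_idem hAne hA hA) _ hcov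
  rw [charOf_eq_true.2 hm, sup_charOf] at this
  obtain ⟨v, hv, hvξ⟩ := this
  obtain ⟨z, hz, rfl⟩ := Finset.mem_image.1 hv
  exact ⟨z, hz, hw3 z hz hvξ⟩

/-- The shift `σ : T⁽¹⁾ → T`, `σ(ξ) = H_{[α₁]γ}(ξ)` if `α₁γ` is the word associated with `ξ`. -/
def shift (ξ : G.tightGE 1) : G.TightSpectrum :=
  ⟨shiftSet ξ.1.1, shiftSet_isTight ξ.1.2 ξ.2⟩

/-! ### The topological correspondence -/

variable (G)

/-- The space `X_α` of ultrafilters in `I_α`. -/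
def X (α : List L) : Type _ := {F : Set B // IsUltrafilterOn (· ≤ ·) ⊥ (G.ideal α) F}

/-- The topology of `X_α` is generated by the sets `Z(α, A) = {F : A ∈ F}`, `A ∈ I_α`. -/
instance (α : List L) : TopologicalSpace (G.X α) :=
  TopologicalSpace.generateFrom {U | ∃ A ∈ G.ideal α, U = {F | A ∈ F.1}}

/-- `E⁰ = X_∅`. -/
abbrev E0 : Type _ := G.X []

/-- `F⁰ = X_∅ ∪ {∅}`: the one-point compactification of `X_∅`, in which the additional point is
isolated if `B` is unital, that is, if `X_∅` is compact. -/
abbrev F0 : Type _ := OnePoint G.E0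

/-- `E¹`: the set of all `e^a_η`, where `a` is a letter and `η ∈ X_a`. -/
structure E1 where
  letter : L
  point : G.X [letter]

/-- The topology of `E¹` is generated by the sets `Z¹(a, A) = {e^a_η : A ∈ η}`, `A ∈ I_a`. -/
instance : TopologicalSpace G.E1 :=
  TopologicalSpace.generateFrom {U | ∃ (a : L) (A : B), A ∈ G.ideal [a] ∧
    U = {e | e.letter = a ∧ A ∈ e.point.1}}

variable {G}

theorem cut_isUltrafilterOn {a : L} (η : G.X [a]) :
    IsUltrafilterOn (· ≤ ·) ⊥ (G.ideal []) (G.cut [] η.1) := by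
  have hη := η.2
  have hC := G.ideal_lower [a]
  refine IsFilterOn.isUltrafilterOn ⟨fun _ h => h.1, ?_, ?_, ?_, ?_⟩ ?_
  · obtain ⟨A, hA⟩ := hη.filter.nonempty
    exact ⟨A, trivial, A, hA, le_rfl⟩
  · rintro ⟨-, A, hA, h⟩
    exact hη.filter.zero_notMem (le_bot_iff.1 h ▸ hA)
  · rintro x ⟨-, A, hA, h⟩ y - hxy
    exact ⟨trivial, A, hA, h.trans hxy⟩
  · rintro x ⟨-, A, hA, h⟩ y ⟨-, A', hA', h'⟩
    exact ⟨x ⊓ y, ⟨trivial, A ⊓ A', hη.filter.inf_mem hC hA hA', inf_le_inf h h'⟩,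
      inf_le_left, inf_le_right⟩
  · rintro x y ⟨-, A, hA, h⟩
    have : (A ⊓ x) ⊔ (A ⊓ y) ∈ η.1 := by rwa [← inf_sup_left, inf_eq_left.2 h]
    rcases hη.prime hC this with h1 | h1
    · exact .inl ⟨trivial, _, h1, inf_le_right⟩
    · exact .inr ⟨trivial, _, h1, inf_le_right⟩

/-- `f_{∅[a]}(η) = {A ∈ B : θ_a(A) ∈ η}`. -/
def pull {a : L} (η : G.X [a]) : Set B := {A | G.θ a A ∈ η.1}

theorem pull_isUltrafilterOn {a : L} (η : G.X [a]) (hne : (pull η).Nonempty) :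
    IsUltrafilterOn (· ≤ ·) ⊥ (G.ideal []) (pull η) := by
  have hη := η.2
  have hC := G.ideal_lower [a]
  refine IsFilterOn.isUltrafilterOn ⟨fun _ _ => trivial, hne, ?_, ?_, ?_⟩ ?_
  · intro h
    have : G.θ a ⊥ ∈ η.1 := h
    rw [G.θ_bot] at this
    exact hη.filter.zero_notMem this
  · intro x hx y _ hxy
    exact hη.filter.up _ hx _ (G.act_mem_ideal [] [a] trivial) (G.act_mono [a] hxy)
  · intro x hx y hy
    refine ⟨x ⊓ y, ?_, inf_le_left, inf_le_right⟩
    change G.θ a (x ⊓ y) ∈ η.1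
    rw [G.θ_inf]
    exact hη.filter.inf_mem hC hx hy
  · intro x y hxy
    have : G.θ a (x ⊔ y) ∈ η.1 := hxy
    rw [G.θ_sup] at this
    exact hη.prime hC this

/-- `d : E¹ → E⁰`, `d(e^a_η) = h_{[a]∅}(η)`. -/
def E1.d (e : G.E1) : G.E0 := ⟨G.cut [] e.point.1, cut_isUltrafilterOn e.point⟩

open Classical in
/-- `r : E¹ → F⁰`, `r(e^a_η) = f_{∅[a]}(η)`, which is an ultrafilter in `B` or empty. -/
noncomputable def E1.r (e : G.E1) : G.F0 :=
  if h : (pull e.point).Nonempty then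
    OnePoint.some (⟨pull e.point, pull_isUltrafilterOn e.point h⟩ : G.X [])
  else OnePoint.infty

/-! ### The boundary path space -/

variable (G)

/-- `F⁰_sce`. -/
def Fsce : Set G.F0 := (closure (range (E1.r (G := G))))ᶜ

/-- `F⁰_fin`. -/
def Ffin : Set G.F0 := {v | ∃ V ∈ 𝓝 v, IsCompact (E1.r (G := G) ⁻¹' V)}

/-- `F⁰_rg`. -/
def Frg : Set G.F0 := G.Ffin \ closure G.Fsce

/-- `F⁰_sg`. -/
def Fsg : Set G.F0 := G.Frgᶜ

/-- `E⁰_sg = F⁰_sg ∩ E⁰`. -/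
def E0sg : Set G.E0 := {v | (v : G.F0) ∈ G.Fsg}

/-- Paths with `n + 1` edges, with the subspace topology of the product. -/
def FinPath (n : ℕ) : Type _ :=
  {p : Fin (n + 1) → G.E1 // ∀ i : Fin n, ((p i.castSucc).d : G.F0) = (p i.succ).r}

instance (n : ℕ) : TopologicalSpace (G.FinPath n) := instTopologicalSpaceSubtype

/-- The finite path space `E* = ⨆ₙ Eⁿ`, with the topology of the disjoint union. A path of length
`n + 1` is in the summand with index `n` on the right. -/
abbrev EStar : Type _ := G.E0 ⊕ Σ n : ℕ, G.FinPath n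

/-- The infinite path space. -/
def InfPath : Type _ := {p : ℕ → G.E1 // ∀ i : ℕ, ((p i).d : G.F0) = (p (i + 1)).r}

variable {G}

/-- `d : E* → E⁰`. -/
def EStar.d : G.EStar → G.E0
  | .inl v => v
  | .inr ⟨n, p⟩ => (p.1 (Fin.last n)).d

variable (G)

/-- The boundary path space `∂E`. -/
inductive Boundary : Type _
  | infinite (p : G.InfPath) : Boundary
  | finite (p : G.EStar) (hp : EStar.d p ∈ G.E0sg) : Boundary

variable {G}

/-- The `k`-th edge of a boundary path, counted from `0`, if there is one. -/
def Boundary.edge : G.Boundary → ℕ → Option G.E1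
  | .infinite p, k => some (p.1 k)
  | .finite (.inl _) _, _ => none
  | .finite (.inr ⟨n, p⟩) _, k => if h : k < n + 1 then some (p.1 ⟨k, h⟩) else none

/-- The range of a boundary path. -/
noncomputable def Boundary.r : G.Boundary → G.F0
  | .infinite p => (p.1 0).r
  | .finite (.inl v) _ => (v : G.F0)
  | .finite (.inr ⟨_, p⟩) _ => (p.1 0).r

/-- `q ∈ E*` is an initial piece of `μ`: a vertex `q ∈ E⁰` with `r(μ) = q`, or
`q = μ₁ ⋯ μᵢ` with `1 ≤ i ≤ |μ|`. -/
def Boundary.HasPrefix (μ : G.Boundary) : G.EStar → Prop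
  | .inl v => μ.r = (v : G.F0)
  | .inr ⟨n, q⟩ => ∀ i : Fin (n + 1), μ.edge i = some (q.1 i)

variable (G)

/-- `𝒵(S)`. -/
def cyl (S : Set G.EStar) : Set G.Boundary := {μ | ∃ q ∈ S, μ.HasPrefix q}

/-- The topology of `∂E` is generated by the sets `𝒵(U) ∩ 𝒵(K)ᶜ`, `U` open and `K` compact in
`E*`. -/
instance : TopologicalSpace G.Boundary :=
  TopologicalSpace.generateFrom
    {W | ∃ U K : Set G.EStar, IsOpen U ∧ IsCompact K ∧ W = G.cyl U ∩ (G.cyl K)ᶜ}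

/-- The domain `∂E ∖ E⁰_sg` of the shift: the boundary paths of positive length. -/
def boundaryPos : Set G.Boundary := {μ | ∀ (v : G.E0) (hv : v ∈ G.E0sg), μ ≠ .finite (.inl v) hv}

variable {G}

/-- The shift `σ_E : ∂E ∖ E⁰_sg → ∂E`, which removes the first edge of a path of length at least `2`
and sends a path `μ` of length `1` to `d(μ)`. -/
def boundaryShift : G.boundaryPos → G.Boundary
  | ⟨.infinite p, _⟩ => .infinite ⟨fun i => p.1 (i + 1), fun i => p.2 (i + 1)⟩
  | ⟨.finite (.inl v) hv, h⟩ => absurd rfl (h v hv)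
  | ⟨.finite (.inr ⟨0, p⟩) hp, _⟩ => .finite (.inl (p.1 0).d) hp
  | ⟨.finite (.inr ⟨n + 1, p⟩) hp, _⟩ =>
    .finite (.inr ⟨n, ⟨fun i => p.1 i.succ, fun i => p.2 i.succ⟩⟩) hp

end GBDS

/-! # The tight spectrum is homeomorphic to the boundary path space -/

namespace GBDS

variable {B L : Type*} [GeneralizedBooleanAlgebra B] {G : GBDS B L}

/-! ### Words, ideals and regular elements -/

/-! A tight filter `ξ` is recorded by its word and its components at the initial segments `β` of
that word. Tightness for the covers of `(β, A ⊔ C, β)` by `(β, A, β)` and `(β, C, β)` makes every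
component prime (`component_sup`), so a nonempty one generates an ultrafilter in `B`, that is, a
vertex. Conversely the component is the trace of this vertex on `I_β`. Compatibility of the
components says that `D` lies in the vertex at `β` iff `θ_a(D)` lies in the vertex at `βa`, which is
the equation `d(e_i) = r(e_{i+1})` for consecutive edges. Hence `ξ` is the filter of a path
(`IsTight.pathFilter_eq`). The component at the empty word may be empty although the word is not;
the path then has range `∞` in `F⁰`.

Beyond primality, tightness only constrains the end of a finite word. If the last component had a
regular element `A`, the finitely many nonzero `(βa, θ_a(A), βa)` would cover `(β, A, β)`, and the
word would continue (`component_append_nonempty_of_isRegular`). If the last vertex has no regular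
element, or the path is infinite, no finite set of idempotents outside the filter covers a member:
far enough along the path there is a nonzero idempotent orthogonal to all of them
(`exists_orthogonal`, `IsPath.isTight`). On the side of paths, `mem_E0sg_iff` translates the
topological definition of a singular vertex into the absence of regular elements. So tight filters
correspond bijectively to boundary paths.

For the topologies, the sets `box β A` of finite paths with word `β` and with `A` in their source
are open, form a basis of `E*` for `A ∈ I_β`, and are then compact. The cylinder of such a box
corresponds to the set of `ξ` containing `(β, A, β)`, and these sets are clopen on both sides. Under
the bijection, the shift deletes the first letter of every word and renumbers the vertices
(`toTight_boundaryShift`). -/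

theorem act_bot (α : List L) : G.act α ⊥ = ⊥ := by
  induction α with
  | nil => rfl
  | cons a t ih => rw [act_cons, G.θ_bot, ih]

theorem act_sup (α : List L) (A C : B) : G.act α (A ⊔ C) = G.act α A ⊔ G.act α C := by
  induction α generalizing A C with
  | nil => rfl
  | cons a t ih => simp [G.θ_sup, ih]

theorem mem_ideal_nil (A : B) : A ∈ G.ideal [] := trivial

theorem θ_mem_ideal (a : L) (A : B) : G.θ a A ∈ G.ideal [a] :=
  G.act_mem_ideal [] [a] (mem_ideal_nil A)

theorem θ_mono (a : L) {A C : B} (h : A ≤ C) : G.θ a A ≤ G.θ a C := G.act_mono [a] h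

theorem ideal_append_subset (β : List L) {γ : List L} :
    G.ideal (β ++ γ) ⊆ G.ideal γ := by
  induction β with
  | nil => exact subset_rfl
  | cons a t ih => exact (G.ideal_cons_subset a _).trans ih

/-- `β` has to be nonempty: the ideal of a single letter `a` may contain elements that lie below no
`θ a C`. -/
theorem exists_le_act_of_mem_ideal {β ε : List L} (hβ : β ≠ []) {A : B}
    (hA : A ∈ G.ideal (β ++ ε)) : ∃ C ∈ G.ideal β, A ≤ G.act ε C := by
  obtain ⟨a, t, rfl⟩ := List.exists_cons_of_ne_nil hβ
  obtain ⟨C, hC, h⟩ := hA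
  refine ⟨G.act t C, ⟨C, hC, le_rfl⟩, ?_⟩
  rwa [← act_append]

variable (G) in
/-- `A` is regular: only finitely many letters act nontrivially on `A`, and every nonzero element
below `A` is acted upon nontrivially by some letter. -/
def IsRegular (A : B) : Prop :=
  {a | G.θ a A ≠ ⊥}.Finite ∧ ∀ C ≤ A, C ≠ ⊥ → ∃ a, G.θ a C ≠ ⊥

theorem IsRegular.mono {A C : B} (h : G.IsRegular A) (hC : C ≤ A) : G.IsRegular C := by
  refine ⟨h.1.subset fun a ha hA => ha ?_, fun D hD => h.2 D (hD.trans hC)⟩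
  exact le_bot_iff.1 ((θ_mono a hC).trans hA.le)

/-! ### Ultrafilters in `B` -/

theorem E0.ext' {v w : G.E0} (h : v.1 = w.1) : v = w := Subtype.ext h

theorem E0.up (v : G.E0) {A C : B} (hA : A ∈ v.1) (h : A ≤ C) : C ∈ v.1 :=
  v.2.filter.up A hA C trivial h

theorem E0.inf_mem (v : G.E0) {A C : B} (hA : A ∈ v.1) (hC : C ∈ v.1) : A ⊓ C ∈ v.1 :=
  v.2.filter.inf_mem (G.ideal_lower []) hA hC

theorem E0.bot_notMem (v : G.E0) : ⊥ ∉ v.1 := v.2.filter.zero_notMem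

theorem E0.ne_bot (v : G.E0) {A : B} (hA : A ∈ v.1) : A ≠ ⊥ := by
  rintro rfl
  exact v.bot_notMem hA

theorem E0.sup_mem (v : G.E0) {A C : B} (h : A ⊔ C ∈ v.1) : A ∈ v.1 ∨ C ∈ v.1 :=
  v.2.prime (G.ideal_lower []) h

theorem E0.sdiff_mem (v : G.E0) {A C : B} (hA : A ∈ v.1) (hC : C ∉ v.1) : A \ C ∈ v.1 := by
  have : (A ⊓ C) ⊔ A \ C ∈ v.1 := by rwa [sup_inf_sdiff]
  exact (v.sup_mem this).resolve_left fun h => hC (v.up h inf_le_right)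

theorem E0.finset_sup_mem (v : G.E0) {ι : Type*} {s : Finset ι} {f : ι → B}
    (h : s.sup f ∈ v.1) : ∃ i ∈ s, f i ∈ v.1 := by
  classical
  induction s using Finset.induction_on with
  | empty => exact absurd h v.bot_notMem
  | insert a s _ ih =>
    rw [Finset.sup_insert] at h
    rcases v.sup_mem h with h | h
    · exact ⟨a, Finset.mem_insert_self _ _, h⟩
    · obtain ⟨i, hi, hv⟩ := ih h
      exact ⟨i, Finset.mem_insert_of_mem hi, hv⟩

theorem E0.eq_of_subset {v w : G.E0} (h : v.1 ⊆ w.1) : v = w :=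
  E0.ext' (v.2.maximal _ w.2.filter h).symm

/-- A prime filter in `B` as a point of `E⁰`. -/
def E0.ofPrime (F : Set B) (hne : F.Nonempty) (hbot : ⊥ ∉ F)
    (hup : ∀ A ∈ F, ∀ C, A ≤ C → C ∈ F) (hinf : ∀ A ∈ F, ∀ C ∈ F, A ⊓ C ∈ F)
    (hsup : ∀ A C, A ⊔ C ∈ F → A ∈ F ∨ C ∈ F) : G.E0 :=
  ⟨F, IsFilterOn.isUltrafilterOn ⟨fun _ _ => trivial, hne, hbot, fun A hA C _ h => hup A hA C h,
    fun A hA C hC => ⟨A ⊓ C, hinf A hA C hC, inf_le_left, inf_le_right⟩⟩ hsup⟩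

-- The complement of a prime ideal that avoids `A` is a prime filter, hence an ultrafilter.
variable (G) in
theorem exists_E0_mem {A : B} (hA : A ≠ ⊥) : ∃ v : G.E0, A ∈ v.1 := by
  obtain ⟨J, hJ, -, hd⟩ := DistribLattice.prime_ideal_of_disjoint_filter_ideal
    (F := Order.PFilter.principal A) (I := Order.Ideal.principal (⊥ : B)) (by
      rw [Set.disjoint_left]
      intro x hx hx'
      exact hA (le_bot_iff.1 (le_trans hx hx')))
  rw [Set.disjoint_left] at hd
  have hA' : A ∉ J := hd (show A ∈ Order.PFilter.principal A from le_rfl)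
  refine ⟨E0.ofPrime {C | C ∉ J} ⟨A, hA'⟩ (fun h => h (Order.Ideal.bot_mem J))
    (fun C hC D h hD => hC (J.lower h hD)) (fun C hC D hD h => ?_) (fun C D h => ?_), hA'⟩
  · rcases hJ.mem_or_mem h with h | h
    · exact hC h
    · exact hD h
  · by_contra! hc
    simp only [mem_ofPred_eq, not_not] at hc
    exact h (Order.Ideal.sup_mem hc.1 hc.2)

/-! ### Edges -/

theorem E1.mem_d {e : G.E1} {D : B} : D ∈ e.d.1 ↔ ∃ A ∈ e.point.1, A ≤ D :=
  ⟨fun h => h.2, fun h => ⟨trivial, h⟩⟩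

/-- An ultrafilter in `I_a` is the trace on `I_a` of the ultrafilter that it generates in `B`. An
edge may therefore be handled through its letter and its source alone. -/
theorem E1.mem_point {e : G.E1} {D : B} :
    D ∈ e.point.1 ↔ D ∈ G.ideal [e.letter] ∧ D ∈ e.d.1 := by
  constructor
  · exact fun h => ⟨e.point.2.filter.subset h, E1.mem_d.2 ⟨D, h, le_rfl⟩⟩
  · rintro ⟨h, h'⟩
    obtain ⟨A, hA, hAD⟩ := E1.mem_d.1 h'
    exact e.point.2.filter.up A hA D h hAD

theorem E1.exists_mem_d (e : G.E1) : ∃ A ∈ G.ideal [e.letter], A ∈ e.d.1 := by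
  obtain ⟨A, hA⟩ := e.point.2.filter.nonempty
  exact ⟨A, E1.mem_point.1 hA⟩

theorem E1.ext' {e f : G.E1} (hl : e.letter = f.letter) (hd : e.d.1 = f.d.1) : e = f := by
  have key : ∀ D, D ∈ e.point.1 ↔ D ∈ f.point.1 := fun D => by
    rw [E1.mem_point, E1.mem_point, hl, hd]
  obtain ⟨a, η⟩ := e
  obtain ⟨b, ζ⟩ := f
  obtain rfl : a = b := hl
  obtain rfl : η = ζ := Subtype.ext (Set.ext key)
  rfl

/-- The edge with letter `a` and source `v`. -/
def E1.of (a : L) (v : G.E0) (h : ∃ A ∈ G.ideal [a], A ∈ v.1) : G.E1 :=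
  ⟨a, {D | D ∈ G.ideal [a] ∧ D ∈ v.1},
    IsFilterOn.isUltrafilterOn ⟨fun _ h => h.1, let ⟨A, h1, h2⟩ := h; ⟨A, h1, h2⟩,
      fun h => v.bot_notMem h.2, fun _ hA _ hC hle => ⟨hC, v.up hA.2 hle⟩,
      fun A hA C hC => ⟨A ⊓ C, ⟨G.ideal_lower _ inf_le_left hA.1, v.inf_mem hA.2 hC.2⟩,
        inf_le_left, inf_le_right⟩⟩
      (fun _ _ h => (v.sup_mem h.2).imp
        (fun h' => ⟨G.ideal_lower _ le_sup_left h.1, h'⟩)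
        (fun h' => ⟨G.ideal_lower _ le_sup_right h.1, h'⟩))⟩

@[simp] theorem E1.of_letter (a : L) (v : G.E0) (h) : (E1.of a v h).letter = a := rfl

@[simp] theorem E1.of_d (a : L) (v : G.E0) (h) : (E1.of a v h).d = v := by
  refine E0.eq_of_subset fun D hD => ?_
  obtain ⟨A, hA, hAD⟩ := E1.mem_d.1 hD
  exact v.up hA.2 hAD

theorem E1.mem_of_d {a : L} {v : G.E0} {h} {D : B} : D ∈ (E1.of a v h).d.1 ↔ D ∈ v.1 := by
  rw [E1.of_d]

/-- The ultrafilter, or the empty set, that is a point of `F⁰`. -/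
def vset (v : G.F0) : Set B := v.elim ∅ fun w : G.E0 => w.1

@[simp] theorem vset_infty : vset (OnePoint.infty : G.F0) = ∅ := rfl

@[simp] theorem vset_coe (v : G.E0) : vset (v : G.F0) = v.1 := rfl

theorem vset_injective : Function.Injective (vset (G := G)) := by
  intro v w h
  induction v using OnePoint.rec with
  | infty =>
    induction w using OnePoint.rec with
    | infty => rfl
    | coe w => exact absurd w.2.filter.nonempty (by rw [vset_coe] at h; rw [← h]; simp)
  | coe v =>
    induction w using OnePoint.rec with
    | infty => exact absurd v.2.filter.nonempty (by rw [vset_coe] at h; rw [h]; simp)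
    | coe w => exact congrArg _ (E0.ext' h)

theorem E1.vset_r (e : G.E1) : vset e.r = pull e.point := by
  unfold E1.r
  split_ifs with h
  · rfl
  · rw [Set.not_nonempty_iff_eq_empty.1 h]; rfl

/-- Since `θ_a(D)` always lies in `I_a`, the range can be read off from the source. -/
theorem E1.mem_vset_r {e : G.E1} {D : B} : D ∈ vset e.r ↔ G.θ e.letter D ∈ e.d.1 := by
  rw [E1.vset_r]
  change G.θ e.letter D ∈ e.point.1 ↔ _
  rw [E1.mem_point]
  exact and_iff_right (θ_mem_ideal _ _)

/-! ### Components of filters -/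

theorem component_subset {ξ : Set G.Semi} (β : List L) : component ξ β ⊆ G.ideal β :=
  fun _ ⟨_, h, _⟩ => h

theorem ne_bot_of_mem_component {ξ : Set G.Semi} {β : List L} {A : B} (h : A ∈ component ξ β) :
    A ≠ ⊥ := h.1

theorem tri_mem_iff {ξ : Set G.Semi} {β : List L} {A : B} {h1 h2 h3} :
    (Semi.tri β A β h1 h2 h3 : G.Semi) ∈ ξ ↔ A ∈ component ξ β :=
  ⟨fun h => ⟨h1, h2, h⟩, fun ⟨_, _, h⟩ => h⟩

theorem mem_component_of_le {ξ : Set G.Semi} (hξ : IsFilterOn Semi.le Semi.zero G.idem ξ)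
    {β ε : List L} {A C : B} (hA : A ∈ component ξ (β ++ ε)) (hC : C ∈ G.ideal β)
    (h : A ≤ G.act ε C) : C ∈ component ξ β := by
  obtain ⟨h1, h2, h3⟩ := hA
  have hC0 : C ≠ ⊥ := by
    rintro rfl
    rw [act_bot] at h
    exact h1 (le_bot_iff.1 h)
  exact ⟨hC0, hC, hξ.up _ h3 _ (Semi.tri_mem_idem _ _ _) (Semi.le_tri_iff.2 ⟨ε, rfl, h⟩)⟩

theorem component_up {ξ : Set G.Semi} (hξ : IsFilterOn Semi.le Semi.zero G.idem ξ)
    {β : List L} {A C : B} (hA : A ∈ component ξ β) (hC : C ∈ G.ideal β)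
    (h : A ≤ C) : C ∈ component ξ β :=
  mem_component_of_le (ε := []) hξ (by simpa using hA) hC h

/-- The word of a common lower bound extends both words. -/
theorem component_comparable {ξ : Set G.Semi} (hξ : IsFilterOn Semi.le Semi.zero G.idem ξ)
    {β γ : List L} (hβ : (component ξ β).Nonempty) (hγ : (component ξ γ).Nonempty) :
    β <+: γ ∨ γ <+: β := by
  obtain ⟨A, hA, hA', hAξ⟩ := hβ
  obtain ⟨C, hC, hC', hCξ⟩ := hγ
  obtain ⟨z, hz, h1, h2⟩ := hξ.down _ hAξ _ hCξ
  obtain ⟨ζ, D, hD, hD', rfl⟩ := exists_tri_of_mem hξ hz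
  obtain ⟨ε, h, -⟩ := Semi.le_tri_iff.1 h1
  obtain ⟨ε', h', -⟩ := Semi.le_tri_iff.1 h2
  exact List.prefix_or_prefix_of_prefix ⟨ε, h.symm⟩ ⟨ε', h'.symm⟩

/-- A common lower bound of the two idempotents lies at a word extending `β ++ ε` and stays below
their meet. -/
theorem inf_act_mem_component {ξ : Set G.Semi} (hξ : IsFilterOn Semi.le Semi.zero G.idem ξ)
    {β ε : List L} {A C : B} (hA : A ∈ component ξ β) (hC : C ∈ component ξ (β ++ ε)) :
    G.act ε A ⊓ C ∈ component ξ (β ++ ε) := by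
  obtain ⟨hA, hA', hAξ⟩ := hA
  obtain ⟨hC, hC', hCξ⟩ := hC
  obtain ⟨z, hz, h1, h2⟩ := hξ.down _ hAξ _ hCξ
  obtain ⟨ζ, D, hD, hD', rfl⟩ := exists_tri_of_mem hξ hz
  obtain ⟨κ, hκ, hDA⟩ := Semi.le_tri_iff.1 h1
  obtain ⟨κ', rfl, hDC⟩ := Semi.le_tri_iff.1 h2
  obtain rfl : κ = ε ++ κ' := by
    rw [List.append_assoc] at hκ
    exact (List.append_cancel_left hκ).symm
  refine mem_component_of_le (ε := κ') hξ (tri_mem_iff.1 hz) (G.ideal_lower _ inf_le_right hC') ?_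
  rw [act_inf, ← act_append]
  exact le_inf hDA hDC

theorem act_mem_component {ξ : Set G.Semi} (hξ : IsFilterOn Semi.le Semi.zero G.idem ξ)
    {β ε : List L} {A : B} (hA : A ∈ component ξ β) (hC : (component ξ (β ++ ε)).Nonempty) :
    G.act ε A ∈ component ξ (β ++ ε) := by
  obtain ⟨C, hC⟩ := hC
  exact component_up hξ (inf_act_mem_component hξ hA hC)
    (G.act_mem_ideal _ _ (component_subset _ hA)) inf_le_left

theorem component_inf {ξ : Set G.Semi} (hξ : IsFilterOn Semi.le Semi.zero G.idem ξ)
    {β : List L} {A C : B} (hA : A ∈ component ξ β) (hC : C ∈ component ξ β) :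
    A ⊓ C ∈ component ξ β := by
  have := inf_act_mem_component (ε := []) hξ hA (by simpa using hC)
  simpa using this

/-- This fails for the empty word, whose component may be empty; in that case the associated path
has range `∞`. -/
theorem component_nonempty_of_append {ξ : Set G.Semi}
    (hξ : IsFilterOn Semi.le Semi.zero G.idem ξ) {β ε : List L} (hβ : β ≠ [])
    (h : (component ξ (β ++ ε)).Nonempty) : (component ξ β).Nonempty := by
  obtain ⟨A, hA⟩ := h
  obtain ⟨C, hC, hAC⟩ := exists_le_act_of_mem_ideal hβ (component_subset _ hA)
  exact ⟨C, mem_component_of_le hξ hA hC hAC⟩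

/-- The two parts form a cover of the join, so tightness yields primality. -/
theorem component_sup {ξ : Set G.Semi} (hξ : IsTight ξ) {β : List L} {A C : B}
    (h : A ⊔ C ∈ component ξ β) : A ∈ component ξ β ∨ C ∈ component ξ β := by
  classical
  have hI := component_subset _ h
  have hA : A ∈ G.ideal β := G.ideal_lower _ le_sup_left hI
  have hC : C ∈ G.ideal β := G.ideal_lower _ le_sup_right hI
  -- The triples of the semigroup need nonzero middle entries, so empty parts are treated apart.
  by_cases hA0 : A = ⊥
  · right; simpa [hA0] using h
  by_cases hC0 : C = ⊥
  · left; simpa [hC0] using h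
  obtain ⟨h1, h2, h3⟩ := h
  have hcov : IsCover (({.tri β A β hA0 hA hA, .tri β C β hC0 hC hC} : Finset G.Semi) :
      Set G.Semi) (.tri β (A ⊔ C) β h1 h2 h2) := by
    constructor
    · intro z hz
      simp only [Finset.coe_insert, Finset.coe_singleton, mem_insert_iff, mem_singleton_iff] at hz
      rcases hz with rfl | rfl
      · exact ⟨Semi.tri_mem_idem _ _ _, Semi.le_tri_iff.2 ⟨[], by simp, le_sup_left⟩⟩
      · exact ⟨Semi.tri_mem_idem _ _ _, Semi.le_tri_iff.2 ⟨[], by simp, le_sup_right⟩⟩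
    · intro y hy hle hy0
      obtain ⟨ω, D, hD0, hD, rfl⟩ := Semi.eq_of_mem_idem hy hy0
      obtain ⟨ε, rfl, hDA⟩ := Semi.le_tri_iff.1 hle
      by_cases hAD : G.act ε A ⊓ D = ⊥
      · refine ⟨.tri β C β hC0 hC hC, by simp, ?_⟩
        rw [Semi.mul_ne_zero_right]
        intro hCD
        apply hD0
        rw [← inf_eq_right.2 hDA, act_sup, inf_sup_right, hAD, hCD, bot_sup_eq]
      · exact ⟨.tri β A β hA0 hA hA, by simp, (Semi.mul_ne_zero_right _ _ _ _ _ _ _ _ _ _).2 hAD⟩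
  have := hξ.tight _ (Semi.tri_mem_idem h1 h2 h2) _ hcov
  rw [charOf_eq_true.2 h3, sup_charOf] at this
  obtain ⟨z, hz, hzξ⟩ := this
  simp only [Finset.mem_insert, Finset.mem_singleton] at hz
  rcases hz with rfl | rfl
  · exact .inl (tri_mem_iff.1 hzξ)
  · exact .inr (tri_mem_iff.1 hzξ)

/-- Regularity of `A` says precisely that the nonzero `(βa, θ_a(A), βa)` are finite in number and
cover `(β, A, β)`. -/
theorem component_append_nonempty_of_isRegular {ξ : Set G.Semi} (hξ : IsTight ξ) {β : List L}
    {A : B} (h : A ∈ component ξ β) (hA : G.IsRegular A) :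
    ∃ a, (component ξ (β ++ [a])).Nonempty := by
  classical
  obtain ⟨h1, h2, h3⟩ := h
  have hI (a : L) : G.θ a A ∈ G.ideal (β ++ [a]) := G.act_mem_ideal β [a] h2
  let f : L → G.Semi := fun a =>
    if ha : G.θ a A ≠ ⊥ then .tri (β ++ [a]) (G.θ a A) (β ++ [a]) ha (hI a) (hI a) else .zero
  have hf {a : L} (ha : G.θ a A ≠ ⊥) :
      f a = .tri (β ++ [a]) (G.θ a A) (β ++ [a]) ha (hI a) (hI a) := dif_pos ha
  have hcov : IsCover ((hA.1.toFinset.image f : Finset G.Semi) : Set G.Semi)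
      (.tri β A β h1 h2 h2) := by
    constructor
    · intro z hz
      simp only [Finset.coe_image, Finite.coe_toFinset, mem_image, mem_ofPred_eq] at hz
      obtain ⟨a, ha, rfl⟩ := hz
      rw [hf ha]
      exact ⟨Semi.tri_mem_idem _ _ _, Semi.le_tri_iff.2 ⟨[a], rfl, le_rfl⟩⟩
    · intro y hy hle hy0
      obtain ⟨ω, D, hD0, hD, rfl⟩ := Semi.eq_of_mem_idem hy hy0
      obtain ⟨ε, rfl, hDA⟩ := Semi.le_tri_iff.1 hle
      have key (a : L) (ha : G.θ a A ≠ ⊥)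
          (h : f a * .tri (β ++ ε) D (β ++ ε) hD0 hD hD ≠ .zero) :
          ∃ z ∈ ((hA.1.toFinset.image f : Finset G.Semi) : Set G.Semi),
            z * .tri (β ++ ε) D (β ++ ε) hD0 hD hD ≠ .zero :=
        ⟨f a, by simpa using ⟨a, ha, rfl⟩, h⟩
      -- An element at the same word `β` is met by some letter because of the second condition in
      -- `IsRegular`. An element at a longer word is met by the idempotent of its next letter.
      cases ε with
      | nil =>
        simp only [act_nil] at hDA
        obtain ⟨a, ha⟩ := hA.2 D hDA hD0
        have ha' : G.θ a A ≠ ⊥ := fun h => ha (le_bot_iff.1 ((θ_mono a hDA).trans h.le))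
        refine key a ha' ?_
        rw [hf ha']
        simp only [List.append_nil]
        rw [Semi.mul_ne_zero_left]
        simpa [inf_eq_right.2 (θ_mono a hDA)] using ha
      | cons a t =>
        have ha' : G.θ a A ≠ ⊥ := by
          intro h
          rw [act_cons, h, act_bot] at hDA
          exact hD0 (le_bot_iff.1 hDA)
        refine key a ha' ?_
        rw [hf ha']
        have hD' : D ∈ G.ideal ((β ++ [a]) ++ t) := by simpa using hD
        have := (Semi.mul_ne_zero_right (G := G) (β ++ [a]) t (G.θ a A) D ha' (hI a) (hI a) hD0
          hD' hD').2 (by rwa [inf_eq_right.2 (show D ≤ G.act t (G.θ a A) from hDA)])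
        simpa only [List.append_assoc, List.singleton_append] using this
  have := hξ.tight _ (Semi.tri_mem_idem h1 h2 h2) _ hcov
  rw [charOf_eq_true.2 h3, sup_charOf] at this
  obtain ⟨z, hz, hzξ⟩ := this
  simp only [Finset.mem_image, Finite.mem_toFinset, mem_ofPred_eq] at hz
  obtain ⟨a, ha, rfl⟩ := hz
  rw [hf ha] at hzξ
  exact ⟨a, _, tri_mem_iff.1 hzξ⟩

/-! ### Paths as sequences of edges -/

/-- `e` is the sequence of edges of a finite or infinite path with range `v`, continued by `none`
after its last edge. -/
structure IsPath (e : ℕ → Option G.E1) (v : G.F0) : Prop where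
  none_succ : ∀ n, e n = none → e (n + 1) = none
  start : ∀ x, e 0 = some x → v = x.r
  comp : ∀ n x y, e n = some x → e (n + 1) = some y → (x.d : G.F0) = y.r

/-- The `n`-th vertex of a path, as a subset of `B`; it is empty if `n` exceeds the length of the
path. -/
def vert (e : ℕ → Option G.E1) (v : G.F0) : ℕ → Set B
  | 0 => vset v
  | n + 1 => (e n).elim ∅ fun x => x.d.1

/-- The word `β` is an initial segment of the word of the path. -/
def HasWord (e : ℕ → Option G.E1) (β : List L) : Prop :=
  ∀ i a, β[i]? = some a → ∃ x, e i = some x ∧ x.letter = a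

section

variable {e : ℕ → Option G.E1} {v : G.F0}

theorem vert_zero : vert e v 0 = vset v := rfl

theorem vert_succ_of_some {n : ℕ} {x : G.E1} (h : e n = some x) : vert e v (n + 1) = x.d.1 := by
  simp [vert, h]

theorem vert_succ_of_none {n : ℕ} (h : e n = none) : vert e v (n + 1) = ∅ := by
  simp [vert, h]

theorem exists_E0_of_mem_vert {n : ℕ} {A : B} (h : A ∈ vert e v n) :
    ∃ w : G.E0, vert e v n = w.1 := by
  cases n with
  | zero =>
    induction v using OnePoint.rec with
    | infty => exact absurd h (notMem_empty A)
    | coe w => exact ⟨w, rfl⟩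
  | succ n =>
    cases hx : e n with
    | none => rw [vert_succ_of_none hx] at h; exact absurd h (notMem_empty A)
    | some x => exact ⟨x.d, vert_succ_of_some hx⟩

theorem hasWord_nil : HasWord e [] := by
  intro i a h
  simp at h

theorem hasWord_concat {β : List L} {a : L} :
    HasWord e (β ++ [a]) ↔ HasWord e β ∧ ∃ x, e β.length = some x ∧ x.letter = a := by
  constructor
  · intro h
    refine ⟨fun i b hb => h i b ?_, h _ _ (by simp)⟩
    rw [List.getElem?_append_left (List.getElem?_eq_some_iff.1 hb).1, hb]
  · rintro ⟨h, hx⟩ i b hb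
    rcases lt_trichotomy i β.length with hi | rfl | hi
    · rw [List.getElem?_append_left hi] at hb
      exact h i b hb
    · simp only [List.getElem?_concat_length, Option.some.injEq] at hb
      rwa [← hb]
    · rw [List.getElem?_eq_none (by simp; omega)] at hb
      cases hb

theorem HasWord.of_append {β ε : List L} (h : HasWord e (β ++ ε)) : HasWord e β :=
  fun i b hb => h i b (by rw [List.getElem?_append_left (List.getElem?_eq_some_iff.1 hb).1, hb])

theorem HasWord.prefix_of_length_le {β γ : List L} (hβ : HasWord e β) (hγ : HasWord e γ)
    (h : β.length ≤ γ.length) : β <+: γ := by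
  rw [List.prefix_iff_eq_take]
  refine List.ext_getElem? fun i => ?_
  by_cases hi : i < β.length
  · obtain ⟨x, hx, hx'⟩ := hβ i _ (List.getElem?_eq_getElem hi)
    obtain ⟨y, hy, hy'⟩ := hγ i _ (List.getElem?_eq_getElem (hi.trans_le h))
    rw [List.getElem?_take_of_lt hi, List.getElem?_eq_getElem hi,
      List.getElem?_eq_getElem (hi.trans_le h), ← hx', ← hy']
    rw [hx] at hy
    cases hy
    rfl
  · rw [List.getElem?_eq_none (by omega), List.getElem?_eq_none (by simp; omega)]

theorem HasWord.prefix_or {β γ : List L} (hβ : HasWord e β) (hγ : HasWord e γ) :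
    β <+: γ ∨ γ <+: β :=
  (le_total β.length γ.length).imp (hβ.prefix_of_length_le hγ) (hγ.prefix_of_length_le hβ)

theorem IsPath.none_of_le (he : IsPath e v) {m n : ℕ} (h : e m = none) (hmn : m ≤ n) :
    e n = none := by
  induction n, hmn using Nat.le_induction with
  | base => exact h
  | succ n _ ih => exact he.none_succ n ih

theorem IsPath.exists_some_of_le (he : IsPath e v) {m n : ℕ} {x : G.E1} (h : e n = some x)
    (hmn : m ≤ n) : ∃ y, e m = some y := by
  by_contra hc
  have : e m = none := by
    cases hm : e m with
    | none => rfl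
    | some y => exact absurd ⟨y, hm⟩ hc
  rw [he.none_of_le this hmn] at h
  cases h

/-- This is the equation `d(e_i) = r(e_{i+1})`, or the condition on the range when `n = 0`, written
in terms of elements of `B`. -/
theorem IsPath.mem_vert_iff (he : IsPath e v) {n : ℕ} {x : G.E1} (hx : e n = some x) {D : B} :
    D ∈ vert e v n ↔ G.θ x.letter D ∈ vert e v (n + 1) := by
  rw [vert_succ_of_some hx, ← E1.mem_vset_r]
  cases n with
  | zero => rw [vert_zero, he.start x hx]
  | succ n =>
    obtain ⟨y, hy⟩ := he.exists_some_of_le hx n.le_succ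
    rw [vert_succ_of_some hy, ← he.comp n y x hy hx, vset_coe]

theorem IsPath.mem_vert_iff_act (he : IsPath e v) {β ε : List L} (h : HasWord e (β ++ ε)) {D : B} :
    D ∈ vert e v β.length ↔ G.act ε D ∈ vert e v (β ++ ε).length := by
  induction ε using List.reverseRecOn with
  | nil => simp
  | append_singleton ε a ih =>
    rw [← List.append_assoc, hasWord_concat] at h
    obtain ⟨h, x, hx, rfl⟩ := h
    rw [ih h, he.mem_vert_iff hx, act_append, ← List.append_assoc, List.length_append (bs := [_]),
      List.length_singleton, act_cons, act_nil]

/-- The first source contains an element of the ideal of its letter, which `θ` carries along the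
path. For the empty word the vertex may be `∞`, which has no elements. -/
theorem IsPath.exists_mem_vert (he : IsPath e v) {β : List L} (hβ : β ≠ []) (h : HasWord e β) :
    ∃ A ∈ G.ideal β, A ∈ vert e v β.length := by
  induction β using List.reverseRecOn with
  | nil => exact absurd rfl hβ
  | append_singleton β a ih =>
    rw [hasWord_concat] at h
    obtain ⟨h, x, hx, rfl⟩ := h
    rw [List.length_append, List.length_singleton]
    by_cases hβ' : β = []
    · subst hβ'
      obtain ⟨A, hA, hAx⟩ := x.exists_mem_d
      refine ⟨A, hA, ?_⟩
      rwa [vert_succ_of_some hx]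
    · obtain ⟨A, hA, hAv⟩ := ih hβ' h
      exact ⟨G.θ x.letter A, G.act_mem_ideal β [x.letter] hA, (he.mem_vert_iff hx).1 hAv⟩

/-! ### The filter of a path -/

variable (e v) in
/-- The filter in `E(S)` of a path: all `(β, A, β)` for which `β` is an initial segment of the word
of the path and `A` belongs to the vertex at the end of `β`. -/
def pathFilter : Set G.Semi :=
  {s | ∃ (β : List L) (A : B) (hne : A ≠ ⊥) (hA : A ∈ G.ideal β),
    s = Semi.tri β A β hne hA hA ∧ HasWord e β ∧ A ∈ vert e v β.length}

theorem tri_mem_pathFilter {β : List L} {A : B} {h1 h2 h3} :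
    (Semi.tri β A β h1 h2 h3 : G.Semi) ∈ pathFilter e v ↔
      HasWord e β ∧ A ∈ vert e v β.length := by
  constructor
  · rintro ⟨γ, C, h, h', heq, hw, hC⟩
    simp only [Semi.tri.injEq] at heq
    obtain ⟨rfl, rfl, -⟩ := heq
    exact ⟨hw, hC⟩
  · exact fun h => ⟨β, A, h1, h2, rfl, h⟩

theorem mem_component_pathFilter {β : List L} {A : B} :
    A ∈ component (pathFilter e v) β ↔
      A ∈ G.ideal β ∧ HasWord e β ∧ A ∈ vert e v β.length := by
  constructor
  · rintro ⟨h1, h2, h3⟩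
    exact ⟨h2, tri_mem_pathFilter.1 h3⟩
  · rintro ⟨h1, h2, h3⟩
    obtain ⟨w, hw⟩ := exists_E0_of_mem_vert h3
    refine ⟨?_, h1, tri_mem_pathFilter.2 ⟨h2, h3⟩⟩
    rintro rfl
    rw [hw] at h3
    exact w.bot_notMem h3

theorem IsPath.isFilterOn (he : IsPath e v) (hne : (pathFilter e v).Nonempty) :
    IsFilterOn Semi.le Semi.zero G.idem (pathFilter e v) := by
  refine ⟨?_, hne, ?_, ?_, ?_⟩
  · rintro s ⟨β, A, h1, h2, rfl, -⟩
    exact Semi.tri_mem_idem _ _ _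
  · rintro ⟨β, A, h1, h2, h, -⟩
    cases h
  · rintro s ⟨β, A, h1, h2, rfl, hw, hA⟩ y hy hle
    have hy0 : y ≠ .zero := by
      rintro rfl
      have h : (Semi.tri β A β h1 h2 h2 : G.Semi) * .zero = _ := hle
      rw [Semi.tri_mul_zero] at h
      cases h
    obtain ⟨γ, C, hC0, hC, rfl⟩ := Semi.eq_of_mem_idem hy hy0
    obtain ⟨ε, rfl, hAC⟩ := Semi.le_tri_iff.1 hle
    refine tri_mem_pathFilter.2 ⟨hw.of_append, (he.mem_vert_iff_act hw).2 ?_⟩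
    obtain ⟨w, hv⟩ := exists_E0_of_mem_vert hA
    rw [hv] at hA ⊢
    exact w.up hA hAC
  -- By symmetry the first word may be taken to be an initial segment of the second; the meet then
  -- lives at the longer word.
  · suffices key : ∀ x ∈ pathFilter e v, ∀ y ∈ pathFilter e v, ∀ β γ A C h1 h2 h3 k1 k2 k3,
        x = Semi.tri β A β h1 h2 h3 → y = Semi.tri γ C γ k1 k2 k3 → β <+: γ →
          ∃ z ∈ pathFilter e v, Semi.le z x ∧ Semi.le z y by
      intro x hx y hy
      obtain ⟨β, A, h1, h2, hx', hβ, hA⟩ := id hx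
      obtain ⟨γ, C, k1, k2, hy', hγ, hC⟩ := id hy
      rcases hβ.prefix_or hγ with h | h
      · exact key x hx y hy _ _ _ _ _ _ _ _ _ _ hx' hy' h
      · obtain ⟨z, hz, hzy, hzx⟩ := key y hy x hx _ _ _ _ _ _ _ _ _ _ hy' hx' h
        exact ⟨z, hz, hzx, hzy⟩
    rintro x hx y hy β γ A C h1 h2 h3 k1 k2 k3 rfl rfl ⟨ε, rfl⟩
    obtain ⟨hβ, hA⟩ := tri_mem_pathFilter.1 hx
    obtain ⟨hγ, hC⟩ := tri_mem_pathFilter.1 hy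
    have hA' := (he.mem_vert_iff_act hγ).1 hA
    obtain ⟨w, hv⟩ := exists_E0_of_mem_vert hC
    rw [hv] at hA' hC
    have hm := w.inf_mem hA' hC
    have hm0 : G.act ε A ⊓ C ≠ ⊥ := w.ne_bot hm
    have hmI := G.ideal_lower _ (inf_le_right (a := G.act ε A)) k2
    exact ⟨.tri _ _ _ hm0 hmI hmI, tri_mem_pathFilter.2 ⟨hγ, by rwa [hv]⟩,
      Semi.le_tri_iff.2 ⟨ε, rfl, inf_le_left⟩, Semi.le_tri_iff.2 ⟨[], by simp, inf_le_right⟩⟩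

end

/-! ### Tightness of the filter of a path -/

/-- The length of the word of an idempotent. -/
def Semi.wordLength : G.Semi → ℕ
  | .zero => 0
  | .tri ω _ _ _ _ _ => ω.length

/-- The first letter after `n` letters of the word of an idempotent. -/
def Semi.letterAt (n : ℕ) : G.Semi → Option L
  | .zero => none
  | .tri ω _ _ _ _ _ => ω[n]?

open Classical in
/-- The element that an idempotent with word `ω` contributes at a word `γ` extending `ω`. -/
noncomputable def Semi.trans (γ : List L) : G.Semi → B
  | .zero => ⊥
  | .tri ω F _ _ _ _ => if ω <+: γ then G.act (γ.drop ω.length) F else ⊥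

theorem Semi.trans_append (ω κ : List L) (F : B) (h1 h2 h3) :
    Semi.trans (ω ++ κ) (.tri ω F ω h1 h2 h3 : G.Semi) = G.act κ F := by
  simp [Semi.trans]

section

variable {e : ℕ → Option G.E1} {v : G.F0}

/-- Whenever finitely many idempotents have words of bounded length, a nonregular element `A` at `γ`
that is disjoint from all of them dominates a nonzero idempotent that is orthogonal to them. -/
theorem exists_orthogonal (Z : Finset G.Semi) (γ : List L) {A : B} (hI : A ∈ G.ideal γ)
    (hA0 : A ≠ ⊥) (hZ : ∀ z ∈ Z, z.trans γ ⊓ A = ⊥)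
    (hA : ¬ G.IsRegular A ∨ ∀ z ∈ Z, z.wordLength < γ.length) (hid : ∀ z ∈ Z, z ∈ G.idem) :
    ∃ (κ : List L) (C : B) (h1 : C ≠ ⊥) (h2 : C ∈ G.ideal (γ ++ κ)), C ≤ G.act κ A ∧
      ∀ z ∈ Z, z * .tri (γ ++ κ) C (γ ++ κ) h1 h2 h2 = .zero := by
  -- By `hZ`, an idempotent of `Z` whose word is an initial segment of `γ` is orthogonal to
  -- everything below `A`. It remains to choose `κ` and `C` so that no other word in `Z` interferes.
  have main : ∀ (κ : List L) (C : B) (h1 : C ≠ ⊥) (h2 : C ∈ G.ideal (γ ++ κ)), C ≤ G.act κ A →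
      (∀ ω F k1 k2, Semi.tri ω F ω k1 k2 k2 ∈ Z → Semi.tri ω F ω k1 k2 k2 *
        .tri (γ ++ κ) C (γ ++ κ) h1 h2 h2 ≠ .zero → ω <+: γ) →
      ∀ z ∈ Z, z * .tri (γ ++ κ) C (γ ++ κ) h1 h2 h2 = .zero := by
    intro κ C h1 h2 hCA h z hz
    by_contra hne
    have hz0 : z ≠ .zero := by
      rintro rfl
      exact hne (Semi.zero_mul _)
    obtain ⟨ω, F, k1, k2, rfl⟩ := Semi.eq_of_mem_idem (hid z hz) hz0
    obtain ⟨ε, rfl⟩ := h ω F k1 k2 hz hne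
    have h2' : C ∈ G.ideal (ω ++ (ε ++ κ)) := by rwa [← List.append_assoc]
    have := (Semi.mul_ne_zero_right (G := G) ω (ε ++ κ) F C k1 k2 k2 h1 h2' h2').1
      (by simpa only [List.append_assoc] using hne)
    apply this
    have hd := hZ _ hz
    rw [Semi.trans_append] at hd
    rw [← inf_eq_right.2 hCA, ← inf_assoc, act_append, ← act_inf, hd, act_bot, bot_inf_eq]
  by_cases hlen : ∀ z ∈ Z, z.wordLength < γ.length
  · have hI' : A ∈ G.ideal (γ ++ []) := by simpa using hI
    refine ⟨[], A, hA0, hI', le_rfl, main [] A hA0 hI' le_rfl fun ω F k1 k2 hz hne => ?_⟩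
    rcases Semi.comparable_of_mul_ne_zero hne with h | h
    · simpa using h
    · have h1 := h.length_le
      have h2 : ω.length < γ.length := hlen _ hz
      simp at h1
      omega
  replace hA := hA.resolve_right hlen
  -- Nonregularity has two causes. If a nonzero `C ≤ A` is killed by every letter, idempotents at
  -- words properly extending `γ` are orthogonal to `C`.
  by_cases hsink : ∃ C ≤ A, C ≠ ⊥ ∧ ∀ a, G.θ a C = ⊥
  · obtain ⟨C, hCA, hC0, hC⟩ := hsink
    have hI' : C ∈ G.ideal (γ ++ []) := by simpa using G.ideal_lower _ hCA hI
    refine ⟨[], C, hC0, hI', hCA, main [] C hC0 hI' hCA fun ω F k1 k2 hz hne => ?_⟩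
    rcases Semi.comparable_of_mul_ne_zero hne with h | ⟨ε, rfl⟩
    · simpa using h
    · have := (Semi.mul_ne_zero_left (G := G) (γ ++ []) ε F C k1 k2 k2 hC0 hI' hI').1 hne
      cases ε with
      | nil => simp
      | cons a t =>
        rw [act_cons, hC, act_bot, inf_bot_eq] at this
        exact absurd rfl this
  · have hinf : {a | G.θ a A ≠ ⊥}.Infinite := by
      intro hfin
      refine hA ⟨hfin, fun C hCA hC0 => ?_⟩
      by_contra! hc
      exact hsink ⟨C, hCA, hC0, hc⟩
    have hfin : {a | ∃ z ∈ Z, z.letterAt γ.length = some a}.Finite := by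
      refine Set.Finite.of_finite_image (f := some) ?_ (Option.some_injective L).injOn
      refine (Z.finite_toSet.image (Semi.letterAt γ.length)).subset ?_
      rintro _ ⟨a, ⟨z, hz, hza⟩, rfl⟩
      exact ⟨z, hz, hza⟩
    -- Otherwise infinitely many letters act nontrivially on `A`, and one of them differs from the
    -- letter after `γ` in every word of `Z`.
    obtain ⟨a, ha, haZ⟩ := (hinf.sdiff hfin).nonempty
    have hI' : G.θ a A ∈ G.ideal (γ ++ [a]) := G.act_mem_ideal γ [a] hI
    refine ⟨[a], G.θ a A, ha, hI', le_rfl, main [a] _ ha hI' le_rfl fun ω F k1 k2 hz hne => ?_⟩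
    have hnp : ¬ γ ++ [a] <+: ω := by
      rintro ⟨ε, rfl⟩
      exact haZ ⟨_, hz, by simp [Semi.letterAt]⟩
    have h := (Semi.comparable_of_mul_ne_zero hne).resolve_right hnp
    rcases List.prefix_concat_iff.1 h with rfl | h
    · exact absurd List.prefix_rfl hnp
    · exact h

theorem HasWord.exists_extension {β : List L} (hβ : HasWord e β) (n : ℕ) :
    ∃ ε, HasWord e (β ++ ε) ∧ (e (β ++ ε).length = none ∨ n < (β ++ ε).length) := by
  induction n with
  | zero =>
    cases hx : e β.length with
    | none => exact ⟨[], by simpa using hβ, .inl (by simpa using hx)⟩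
    | some x => exact ⟨[x.letter], hasWord_concat.2 ⟨hβ, x, hx, rfl⟩, .inr (by simp)⟩
  | succ n ih =>
    obtain ⟨ε, hε, h⟩ := ih
    cases hx : e (β ++ ε).length with
    | none => exact ⟨ε, hε, .inl hx⟩
    | some x =>
      rw [hx] at h
      refine ⟨ε ++ [x.letter], ?_, .inr ?_⟩
      · rw [← List.append_assoc]
        exact hasWord_concat.2 ⟨hε, x, hx, rfl⟩
      · rw [← List.append_assoc, List.length_append, List.length_singleton]
        have := h.resolve_left (by simp)
        omega

/-- Suppose that no element of the cover `Z` is in the filter. Following the path past all words in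
`Z`, or to its end, one arrives at a vertex containing none of the contributions of `Z`. Subtracting
them leaves an element to which `exists_orthogonal` applies, against the covering property. -/
theorem IsPath.isTight (he : IsPath e v) (hne : (pathFilter e v).Nonempty)
    (hend : ∀ n, e n = none → ∀ A ∈ vert e v n, ¬ G.IsRegular A) : IsTight (pathFilter e v) := by
  have hF := he.isFilterOn hne
  refine ⟨hF, fun x hx Z hZ => ?_⟩
  rw [Bool.eq_iff_iff, sup_charOf, charOf_eq_true]
  refine ⟨fun ⟨z, hz, hzξ⟩ => hF.up z hzξ x hx (hZ.1 z hz).2, ?_⟩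
  rintro ⟨β, A, h1, h2, rfl, hβ, hA⟩
  by_contra! hc
  obtain ⟨ε, hε, hlong⟩ := hβ.exists_extension (Z.sup Semi.wordLength)
  have hA' := (he.mem_vert_iff_act hε).1 hA
  obtain ⟨w, hw⟩ := exists_E0_of_mem_vert hA'
  have hZv : Z.sup (Semi.trans (β ++ ε)) ∉ w.1 := by
    intro h
    obtain ⟨z, hz, hzw⟩ := w.finset_sup_mem h
    apply hc z hz
    have hz0 : z ≠ .zero := by
      rintro rfl
      exact w.bot_notMem hzw
    obtain ⟨ω, F, k1, k2, rfl⟩ := Semi.eq_of_mem_idem (hZ.1 z hz).1 hz0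
    by_cases hp : ω <+: β ++ ε
    · obtain ⟨κ, hκ⟩ := hp
      rw [← hκ, Semi.trans_append, ← hw, ← hκ] at hzw
      rw [← hκ] at hε
      exact tri_mem_pathFilter.2 ⟨hε.of_append, (he.mem_vert_iff_act hε).2 hzw⟩
    · simp only [Semi.trans, if_neg hp] at hzw
      exact absurd hzw w.bot_notMem
  rw [hw] at hA'
  have hm := w.sdiff_mem hA' hZv
  have hm0 : G.act ε A \ Z.sup (Semi.trans (β ++ ε)) ≠ ⊥ := w.ne_bot hm
  have hmI : G.act ε A \ Z.sup (Semi.trans (β ++ ε)) ∈ G.ideal (β ++ ε) :=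
    G.ideal_lower _ sdiff_le (G.act_mem_ideal β ε h2)
  obtain ⟨κ, C, k1, k2, hC, horth⟩ := exists_orthogonal Z (β ++ ε) hmI hm0
    (fun z hz => (disjoint_sdiff_self_right.mono_left (Finset.le_sup hz)).eq_bot)
    (hlong.imp (fun h => hend _ h _ (by rwa [hw])) fun h z hz => (Finset.le_sup hz).trans_lt h)
    (fun z hz => (hZ.1 z hz).1)
  obtain ⟨z, hz, hzy⟩ := hZ.2 (.tri (β ++ ε ++ κ) C (β ++ ε ++ κ) k1 k2 k2)
    (Semi.tri_mem_idem _ _ _)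
    (Semi.le_tri_iff.2 ⟨ε ++ κ, by simp, by
      rw [act_append]
      exact hC.trans (G.act_mono κ sdiff_le)⟩) (by simp)
  exact hzy (horth z hz)

end

/-! ### Topology of vertices and edges -/

theorem isOpen_E0_mem (A : B) : IsOpen {v : G.E0 | A ∈ v.1} :=
  TopologicalSpace.isOpen_generateFrom_of_mem ⟨A, trivial, rfl⟩

/-- The generating sets are closed under intersection and cover the space, so they form a basis. -/
theorem exists_mem_E0_subset {O : Set G.E0} (hO : IsOpen O) {v : G.E0} (hv : v ∈ O) :
    ∃ A ∈ v.1, {w : G.E0 | A ∈ w.1} ⊆ O := by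
  induction hO with
  | basic s hs =>
    obtain ⟨A, -, rfl⟩ := hs
    exact ⟨A, hv, subset_rfl⟩
  | univ =>
    obtain ⟨A, hA⟩ := v.2.filter.nonempty
    exact ⟨A, hA, subset_univ _⟩
  | inter s t _ _ ihs iht =>
    obtain ⟨A, hA, hs⟩ := ihs hv.1
    obtain ⟨C, hC, ht⟩ := iht hv.2
    exact ⟨A ⊓ C, v.inf_mem hA hC,
      fun w hw => ⟨hs (w.up hw inf_le_left), ht (w.up hw inf_le_right)⟩⟩
  | sUnion S _ ih =>
    obtain ⟨s, hs, hvs⟩ := hv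
    obtain ⟨A, hA, h⟩ := ih s hs hvs
    exact ⟨A, hA, h.trans (subset_sUnion_of_mem hs)⟩

theorem E0.exists_mem_disjoint {v w : G.E0} (h : v ≠ w) :
    ∃ A ∈ v.1, ∃ C ∈ w.1, A ⊓ C = ⊥ := by
  have hn : ¬ v.1 ⊆ w.1 := fun hs => h (E0.eq_of_subset hs)
  obtain ⟨A, hA, hAw⟩ := Set.not_subset.1 hn
  obtain ⟨C, hC⟩ := w.2.filter.nonempty
  exact ⟨A, hA, C \ A, w.sdiff_mem hC hAw, inf_sdiff_self_right⟩

instance : T2Space G.E0 := by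
  refine ⟨fun v w h => ?_⟩
  obtain ⟨A, hA, C, hC, hAC⟩ := E0.exists_mem_disjoint h
  refine ⟨_, _, isOpen_E0_mem A, isOpen_E0_mem C, hA, hC, ?_⟩
  rw [Set.disjoint_left]
  exact fun u hu hu' => u.ne_bot (u.inf_mem hu hu') hAC

/-- An ultrafilter `𝓤` of points converges to the prime filter of those `D` for which `𝓤`-almost
every point contains `D`. -/
theorem isCompact_E0_mem (A : B) : IsCompact {v : G.E0 | A ∈ v.1} := by
  rw [isCompact_iff_ultrafilter_le_nhds]
  intro 𝓤 h𝓤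
  rw [Filter.le_principal_iff] at h𝓤
  let w : G.E0 := E0.ofPrime {D | {v : G.E0 | D ∈ v.1} ∈ 𝓤} ⟨A, h𝓤⟩
    (fun h => by
      have : {v : G.E0 | ⊥ ∈ v.1} = ∅ := Set.eq_empty_of_forall_notMem fun v hv => v.bot_notMem hv
      rw [mem_ofPred_eq, this] at h
      exact 𝓤.empty_notMem h)
    (fun D hD C h => Filter.mem_of_superset hD fun v hv => v.up hv h)
    (fun D hD C hC => Filter.mem_of_superset (Filter.inter_mem hD hC)
      fun v hv => v.inf_mem hv.1 hv.2)
    (fun D C h => by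
      refine Ultrafilter.union_mem_iff.1 (Filter.mem_of_superset h fun v hv => ?_)
      exact v.sup_mem hv)
  refine ⟨w, h𝓤, fun s hs => ?_⟩
  obtain ⟨O, hOs, hO, hw⟩ := mem_nhds_iff.1 hs
  obtain ⟨D, hD, hDO⟩ := exists_mem_E0_subset hO hw
  exact Filter.mem_of_superset hD (hDO.trans hOs)

/-- Here `A` need not lie in `I_a`, so the set is a union of generating sets rather than one of
them. -/
theorem isOpen_E1_mem_d (a : L) (A : B) : IsOpen {e : G.E1 | e.letter = a ∧ A ∈ e.d.1} := by
  have : {e : G.E1 | e.letter = a ∧ A ∈ e.d.1} =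
      ⋃ C ∈ {C | C ∈ G.ideal [a] ∧ C ≤ A}, {e : G.E1 | e.letter = a ∧ C ∈ e.point.1} := by
    ext e
    simp only [mem_ofPred_eq, mem_iUnion, exists_prop]
    constructor
    · rintro ⟨rfl, h⟩
      obtain ⟨C, hC, hCA⟩ := E1.mem_d.1 h
      exact ⟨C, ⟨(E1.mem_point.1 hC).1, hCA⟩, rfl, hC⟩
    · rintro ⟨C, ⟨-, hCA⟩, rfl, hC⟩
      exact ⟨rfl, E1.mem_d.2 ⟨C, hC, hCA⟩⟩
  rw [this]
  exact isOpen_biUnion fun C hC =>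
    TopologicalSpace.isOpen_generateFrom_of_mem ⟨a, C, hC.1, rfl⟩

theorem isOpen_E1_letter (a : L) : IsOpen {e : G.E1 | e.letter = a} := by
  have : {e : G.E1 | e.letter = a} = ⋃ A : B, {e : G.E1 | e.letter = a ∧ A ∈ e.d.1} := by
    ext e
    simp only [mem_ofPred_eq, mem_iUnion, exists_and_left, iff_self_and]
    exact fun _ => e.d.2.filter.nonempty
  rw [this]
  exact isOpen_iUnion fun A => isOpen_E1_mem_d a A

theorem isOpen_E1_d (A : B) : IsOpen {e : G.E1 | A ∈ e.d.1} := by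
  have : {e : G.E1 | A ∈ e.d.1} = ⋃ a : L, {e : G.E1 | e.letter = a ∧ A ∈ e.d.1} := by
    ext e
    simp
  rw [this]
  exact isOpen_iUnion fun a => isOpen_E1_mem_d a A

theorem continuous_E1_of {Y : Type*} [TopologicalSpace Y] {f : Y → G.E1}
    (hl : ∀ a, IsOpen {y | (f y).letter = a}) (hd : ∀ A, IsOpen {y | A ∈ (f y).d.1}) :
    Continuous f := by
  refine continuous_generateFrom_iff.2 ?_
  rintro _ ⟨a, A, hA, rfl⟩
  have : f ⁻¹' {e | e.letter = a ∧ A ∈ e.point.1} =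
      {y | (f y).letter = a} ∩ {y | A ∈ (f y).d.1} := by
    ext y
    simp only [mem_preimage, mem_ofPred_eq, mem_inter_iff, E1.mem_point]
    refine and_congr_right fun h => ?_
    subst h
    exact and_iff_right hA
  rw [this]
  exact (hl a).inter (hd A)

theorem exists_mem_E1_subset {O : Set G.E1} (hO : IsOpen O) {e : G.E1} (he : e ∈ O) :
    ∃ A ∈ e.d.1, {f : G.E1 | f.letter = e.letter ∧ A ∈ f.d.1} ⊆ O := by
  suffices ∃ A ∈ e.point.1, {f : G.E1 | f.letter = e.letter ∧ A ∈ f.point.1} ⊆ O by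
    obtain ⟨A, hA, h⟩ := this
    rw [E1.mem_point] at hA
    refine ⟨A, hA.2, fun f hf => h ⟨hf.1, E1.mem_point.2 ⟨?_, hf.2⟩⟩⟩
    rw [hf.1]
    exact hA.1
  induction hO with
  | basic s hs =>
    obtain ⟨a, A, -, rfl⟩ := hs
    obtain ⟨rfl, hA⟩ := he
    exact ⟨A, hA, subset_rfl⟩
  | univ =>
    obtain ⟨A, hA⟩ := e.point.2.filter.nonempty
    exact ⟨A, hA, subset_univ _⟩
  | inter s t _ _ ihs iht =>
    obtain ⟨A, hA, hs⟩ := ihs he.1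
    obtain ⟨C, hC, ht⟩ := iht he.2
    rw [E1.mem_point] at hA hC
    refine ⟨A ⊓ C, E1.mem_point.2 ⟨G.ideal_lower _ inf_le_left hA.1, e.d.inf_mem hA.2 hC.2⟩,
      fun f hf => ⟨hs ⟨hf.1, ?_⟩, ht ⟨hf.1, ?_⟩⟩⟩
    · exact E1.mem_point.2 ⟨by rw [hf.1]; exact hA.1, f.d.up (E1.mem_point.1 hf.2).2 inf_le_left⟩
    · exact E1.mem_point.2 ⟨by rw [hf.1]; exact hC.1, f.d.up (E1.mem_point.1 hf.2).2 inf_le_right⟩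
  | sUnion S _ ih =>
    obtain ⟨s, hs, hvs⟩ := he
    obtain ⟨A, hA, h⟩ := ih s hs hvs
    exact ⟨A, hA, h.trans (subset_sUnion_of_mem hs)⟩

instance : T2Space G.E1 := by
  refine ⟨fun e f h => ?_⟩
  by_cases hl : e.letter = f.letter
  · have hd : e.d ≠ f.d := fun hd => h (E1.ext' hl (by rw [hd]))
    obtain ⟨A, hA, C, hC, hAC⟩ := E0.exists_mem_disjoint hd
    refine ⟨_, _, isOpen_E1_d A, isOpen_E1_d C, hA, hC, ?_⟩
    rw [Set.disjoint_left]
    exact fun u hu hu' => u.d.ne_bot (u.d.inf_mem hu hu') hAC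
  · refine ⟨_, _, isOpen_E1_letter e.letter, isOpen_E1_letter f.letter, rfl, rfl, ?_⟩
    rw [Set.disjoint_left]
    exact fun u hu hu' => hl (hu.symm.trans hu')

/-- As `A ∈ I_a`, every `v` containing `A` is the source of an edge with letter `a`, and the set is
a continuous image of the compact set of such `v`. -/
theorem isCompact_E1_mem_d {a : L} {A : B} (hA : A ∈ G.ideal [a]) :
    IsCompact {e : G.E1 | e.letter = a ∧ A ∈ e.d.1} := by
  let f : {v : G.E0 // A ∈ v.1} → G.E1 := fun v => E1.of a v.1 ⟨A, hA, v.2⟩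
  have hf : Continuous f := by
    refine continuous_E1_of (fun b => ?_) (fun D => ?_)
    · change IsOpen {_v : {v : G.E0 // A ∈ v.1} | a = b}
      exact isOpen_const
    · simp only [f, E1.of_d]
      exact (isOpen_E0_mem D).preimage continuous_subtype_val
  have : CompactSpace {v : G.E0 // A ∈ v.1} := isCompact_iff_compactSpace.1 (isCompact_E0_mem A)
  convert isCompact_range hf
  ext e
  constructor
  · rintro ⟨rfl, h⟩
    exact ⟨⟨e.d, h⟩, E1.ext' rfl (by simp [f])⟩
  · rintro ⟨v, rfl⟩
    exact ⟨rfl, by simpa [f] using v.2⟩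

/-! ### Singular vertices -/

theorem mem_coe_image_iff {A : B} {x : G.F0} :
    x ∈ ((↑) : G.E0 → G.F0) '' {v | A ∈ v.1} ↔ A ∈ vset x := by
  constructor
  · rintro ⟨v, hv, rfl⟩
    exact hv
  · intro h
    induction x using OnePoint.rec with
    | infty => exact absurd h (notMem_empty A)
    | coe w => exact ⟨w, h, rfl⟩

theorem isOpen_F0_mem (A : B) : IsOpen {x : G.F0 | A ∈ vset x} := by
  have : {x : G.F0 | A ∈ vset x} = ((↑) : G.E0 → G.F0) '' {v | A ∈ v.1} :=
    Set.ext fun x => mem_coe_image_iff.symm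
  rw [this]
  exact OnePoint.isOpenEmbedding_coe.isOpenMap _ (isOpen_E0_mem A)

theorem exists_mem_F0_subset {O : Set G.F0} (hO : IsOpen O) {v : G.E0} (hv : (v : G.F0) ∈ O) :
    ∃ A ∈ v.1, {x : G.F0 | A ∈ vset x} ⊆ O := by
  obtain ⟨A, hA, h⟩ := exists_mem_E0_subset (hO.preimage OnePoint.continuous_coe) hv
  refine ⟨A, hA, fun x hx => ?_⟩
  obtain ⟨w, hw, rfl⟩ := mem_coe_image_iff.2 hx
  exact h hw

/-- If `θ_a(A)` is not in the source of `e`, some `C \ θ_a(A)` is, and this excludes `A` from the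
range of all nearby edges. Closedness serves to pass compactness from the preimage of a
neighbourhood to that of a smaller basic one. -/
theorem isClosed_preimage_r (A : B) : IsClosed {e : G.E1 | A ∈ vset e.r} := by
  have : {e : G.E1 | A ∈ vset e.r} = ⋂ a : L, {e : G.E1 | e.letter = a ∧ G.θ a A ∉ e.d.1}ᶜ := by
    ext e
    simp [E1.mem_vset_r]
  rw [this]
  refine isClosed_iInter fun a => IsOpen.isClosed_compl ?_
  rw [isOpen_iff_forall_mem_open]
  rintro e ⟨rfl, he⟩
  obtain ⟨C, hC⟩ := e.d.2.filter.nonempty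
  refine ⟨_, fun f hf => ⟨hf.1, fun h => ?_⟩, isOpen_E1_mem_d e.letter (C \ G.θ e.letter A),
    rfl, e.d.sdiff_mem hC he⟩
  have := f.d.inf_mem h hf.2
  rw [inf_sdiff_self_right] at this
  exact f.d.bot_notMem this

theorem exists_E1_mem {a : L} {A : B} (h : G.θ a A ≠ ⊥) :
    ∃ e : G.E1, e.letter = a ∧ A ∈ vset e.r := by
  obtain ⟨v, hv⟩ := exists_E0_mem G h
  exact ⟨E1.of a v ⟨_, θ_mem_ideal a A, hv⟩, rfl, E1.mem_vset_r.2 (by simpa using hv)⟩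

/-- Finiteness of the set of letters makes the preimage under `r` of the neighbourhood given by `A`
a finite union of compact sets. The second condition makes the range of `r` dense in that
neighbourhood, which thus misses `Fsce`. -/
theorem IsRegular.mem_Frg {A : B} (hA : G.IsRegular A) {v : G.E0} (hv : A ∈ v.1) :
    (v : G.F0) ∈ G.Frg := by
  refine ⟨⟨_, (isOpen_F0_mem A).mem_nhds hv, ?_⟩, fun hcl => ?_⟩
  · have : E1.r (G := G) ⁻¹' {x | A ∈ vset x} =
        ⋃ a ∈ {a | G.θ a A ≠ ⊥}, {e : G.E1 | e.letter = a ∧ G.θ a A ∈ e.d.1} := by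
      ext e
      simp only [mem_preimage, mem_ofPred_eq, E1.mem_vset_r, mem_iUnion, exists_prop]
      constructor
      · exact fun h => ⟨_, e.d.ne_bot h, rfl, h⟩
      · rintro ⟨a, -, rfl, h⟩
        exact h
    rw [this]
    exact hA.1.isCompact_biUnion fun a _ => isCompact_E1_mem_d (θ_mem_ideal a A)
  · obtain ⟨x, hx, hxs⟩ := mem_closure_iff.1 hcl _ (isOpen_F0_mem A) hv
    apply hxs
    rw [mem_closure_iff]
    intro O hO hxO
    obtain ⟨w, hw, rfl⟩ := mem_coe_image_iff.2 hx
    obtain ⟨C, hC, hCO⟩ := exists_mem_F0_subset hO hxO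
    have hm := w.inf_mem hw hC
    obtain ⟨a, ha⟩ := hA.2 (A ⊓ C) inf_le_left (w.ne_bot hm)
    obtain ⟨e, -, he⟩ := exists_E1_mem ha
    refine ⟨e.r, hCO ?_, mem_range_self e⟩
    rw [mem_ofPred_eq, E1.mem_vset_r] at *
    exact e.d.up he (θ_mono _ inf_le_right)

/-- A compact preimage meets only finitely many of the open sets of edges with a given letter. A
nonzero `C` killed by all letters would give a vertex with a neighbourhood disjoint from the range
of `r`, hence a point of `Fsce`. -/
theorem exists_isRegular_of_mem_Frg {v : G.E0} (hv : (v : G.F0) ∈ G.Frg) :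
    ∃ A ∈ v.1, G.IsRegular A := by
  obtain ⟨⟨V, hV, hc⟩, hcl⟩ := hv
  obtain ⟨O, hOV, hO, hvO⟩ := mem_nhds_iff.1 hV
  obtain ⟨A, hA, hAO⟩ := exists_mem_F0_subset (hO.inter isClosed_closure.isOpen_compl) ⟨hvO, hcl⟩
  refine ⟨A, hA, ?_, fun C hCA hC0 => ?_⟩
  · have hK : IsCompact {e : G.E1 | A ∈ vset e.r} :=
      hc.of_isClosed_subset (isClosed_preimage_r A) fun e he => hOV (hAO he).1
    obtain ⟨t, ht⟩ := hK.elim_finite_subcover (fun a : L => {e : G.E1 | e.letter = a})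
      isOpen_E1_letter fun e _ => mem_iUnion.2 ⟨e.letter, rfl⟩
    refine t.finite_toSet.subset fun a ha => ?_
    obtain ⟨e, rfl, he⟩ := exists_E1_mem ha
    obtain ⟨b, hb, hb'⟩ := mem_iUnion₂.1 (ht he)
    obtain rfl : e.letter = b := hb'
    exact hb
  · by_contra! hC
    obtain ⟨w, hw⟩ := exists_E0_mem G hC0
    refine (hAO (a := (w : G.F0)) (w.up hw hCA)).2 (subset_closure fun hr => ?_)
    obtain ⟨_, hx, e, rfl⟩ := mem_closure_iff.1 hr _ (isOpen_F0_mem C) hw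
    rw [mem_ofPred_eq, E1.mem_vset_r, hC] at hx
    exact e.d.bot_notMem hx

theorem mem_E0sg_iff {v : G.E0} : v ∈ G.E0sg ↔ ∀ A ∈ v.1, ¬ G.IsRegular A := by
  constructor
  · exact fun h A hA hr => h (hr.mem_Frg hA)
  · intro h hv
    obtain ⟨A, hA, hr⟩ := exists_isRegular_of_mem_Frg hv
    exact h A hA hr

/-! ### Edge sequences of finite paths and of boundary paths -/

/-- The `k`-th edge of a finite path, counted from `0`, if there is one. -/
def EStar.edge : G.EStar → ℕ → Option G.E1
  | .inl _, _ => none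
  | .inr ⟨n, p⟩, k => if h : k < n + 1 then some (p.1 ⟨k, h⟩) else none

/-- The range of a finite path. -/
noncomputable def EStar.r : G.EStar → G.F0
  | .inl v => (v : G.F0)
  | .inr ⟨_, p⟩ => (p.1 0).r

/-- The length of a finite path. -/
def EStar.length : G.EStar → ℕ
  | .inl _ => 0
  | .inr ⟨n, _⟩ => n + 1

theorem FinPath.edge_of_lt {n : ℕ} (p : G.FinPath n) {k : ℕ} (h : k < n + 1) :
    EStar.edge (.inr ⟨n, p⟩ : G.EStar) k = some (p.1 ⟨k, h⟩) := dif_pos h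

theorem FinPath.edge_of_le {n : ℕ} (p : G.FinPath n) {k : ℕ} (h : n + 1 ≤ k) :
    EStar.edge (.inr ⟨n, p⟩ : G.EStar) k = none := dif_neg (by omega)

theorem EStar.edge_eq_none_iff {q : G.EStar} {k : ℕ} : q.edge k = none ↔ q.length ≤ k := by
  rcases q with v | ⟨n, p⟩
  · simp [EStar.edge, EStar.length]
  · simp [EStar.edge, EStar.length]

theorem EStar.isPath (q : G.EStar) : IsPath q.edge q.r := by
  rcases q with v | ⟨n, p⟩
  · exact ⟨fun _ _ => rfl, fun _ h => (by cases h), fun _ _ _ h => (by cases h)⟩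
  · refine ⟨fun k hk => ?_, fun x hx => ?_, fun k x y hx hy => ?_⟩
    · rw [EStar.edge_eq_none_iff] at hk ⊢
      omega
    · rw [FinPath.edge_of_lt p n.succ_pos] at hx
      cases hx
      rfl
    · have hk : k + 1 < n + 1 := by
        by_contra hc
        rw [FinPath.edge_of_le p (by omega)] at hy
        cases hy
      rw [FinPath.edge_of_lt p hk] at hy
      rw [FinPath.edge_of_lt p (by omega)] at hx
      cases hx
      cases hy
      exact p.2 ⟨k, by omega⟩

theorem EStar.vert_length (q : G.EStar) : vert q.edge q.r q.length = q.d.1 := by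
  rcases q with v | ⟨n, p⟩
  · rfl
  · exact vert_succ_of_some (FinPath.edge_of_lt p n.lt_succ_self)

/-- The range is needed only for paths of length 0; otherwise the first edge determines it. -/
theorem EStar.ext' {p q : G.EStar} (he : p.edge = q.edge) (hr : p.r = q.r) : p = q := by
  have hlen : p.length = q.length := by
    refine eq_of_forall_ge_iff fun k => ?_
    rw [← EStar.edge_eq_none_iff, ← EStar.edge_eq_none_iff, he]
  rcases p with v | ⟨m, p⟩ <;> rcases q with w | ⟨n, q⟩
  · exact congrArg Sum.inl (OnePoint.coe_injective hr)
  · cases hlen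
  · cases hlen
  · obtain rfl : m = n := Nat.succ_injective hlen
    suffices p = q by rw [this]
    refine Subtype.ext (funext fun i => ?_)
    have := congrFun he i
    rw [FinPath.edge_of_lt p i.2, FinPath.edge_of_lt q i.2] at this
    exact Option.some_injective _ this

theorem Boundary.edge_finite (q : G.EStar) (h) : (Boundary.finite q h).edge = q.edge := by
  rcases q with v | ⟨n, p⟩ <;> rfl

theorem Boundary.r_finite (q : G.EStar) (h) : (Boundary.finite q h).r = q.r := by
  rcases q with v | ⟨n, p⟩ <;> rfl

theorem Boundary.isPath (μ : G.Boundary) : IsPath μ.edge μ.r := by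
  cases μ with
  | infinite p =>
    refine ⟨fun _ h => (by cases h), fun x h => ?_, fun n x y hx hy => ?_⟩
    · cases h
      rfl
    · cases hx
      cases hy
      exact p.2 n
  | finite q h =>
    rw [Boundary.edge_finite, Boundary.r_finite]
    exact q.isPath

theorem Boundary.not_isRegular (μ : G.Boundary) {n : ℕ} (hn : μ.edge n = none) {A : B}
    (hA : A ∈ vert μ.edge μ.r n) : ¬ G.IsRegular A := by
  cases μ with
  | infinite p => cases hn
  | finite q h =>
    rw [Boundary.edge_finite] at hn hA
    rw [Boundary.r_finite] at hA
    have hle := EStar.edge_eq_none_iff.1 hn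
    -- At the length of the path the vertex is its singular source; beyond the length, `vert` is
    -- empty by convention.
    rcases hle.eq_or_lt with rfl | hlt
    · rw [EStar.vert_length] at hA
      exact mem_E0sg_iff.1 h A hA
    · obtain ⟨m, rfl⟩ := Nat.exists_eq_succ_of_ne_zero (Nat.ne_zero_of_lt hlt)
      rw [vert_succ_of_none (EStar.edge_eq_none_iff.2 (Nat.lt_succ_iff.1 hlt))] at hA
      exact absurd hA (notMem_empty A)

theorem Boundary.ext' {μ ν : G.Boundary} (he : μ.edge = ν.edge) (hr : μ.r = ν.r) : μ = ν := by
  cases μ with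
  | infinite p =>
    cases ν with
    | infinite q =>
      exact congrArg Boundary.infinite
        (Subtype.ext (funext fun n => Option.some_injective _ (congrFun he n)))
    | finite q h =>
      rw [Boundary.edge_finite] at he
      have := (EStar.edge_eq_none_iff (q := q)).2 le_rfl
      rw [← he] at this
      cases this
  | finite p h =>
    rw [Boundary.edge_finite] at he
    rw [Boundary.r_finite] at hr
    cases ν with
    | infinite q =>
      have := (EStar.edge_eq_none_iff (q := p)).2 le_rfl
      rw [he] at this
      cases this
    | finite q h' =>
      rw [Boundary.edge_finite] at he
      rw [Boundary.r_finite] at hr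
      obtain rfl := EStar.ext' he hr
      rfl

/-- A finite edge sequence comes from a finite path. -/
theorem IsPath.exists_EStar {e : ℕ → Option G.E1} {v : G.F0} (he : IsPath e v) {n : ℕ}
    (hlt : ∀ k < n, e k ≠ none) (hv : n = 0 → v ≠ OnePoint.infty) :
    ∃ q : G.EStar, q.length = n ∧ (∀ k < n, q.edge k = e k) ∧ q.r = v := by
  cases n with
  | zero =>
    obtain ⟨w, rfl⟩ := OnePoint.ne_infty_iff_exists.1 (hv rfl)
    exact ⟨.inl w, rfl, fun k hk => absurd hk k.not_lt_zero, rfl⟩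
  | succ n =>
    choose p hp using fun i : Fin (n + 1) => Option.ne_none_iff_exists'.1 (hlt i i.2)
    refine ⟨.inr ⟨n, p, fun i => ?_⟩, rfl, fun k hk => ?_, ?_⟩
    · exact he.comp i _ _ (hp i.castSucc) (hp i.succ)
    · exact (FinPath.edge_of_lt _ hk).trans (hp ⟨k, hk⟩).symm
    · exact (he.start _ (hp 0)).symm

/-- An edge sequence whose final vertex, if there is one, is singular comes from a boundary path. -/
theorem IsPath.exists_boundary {e : ℕ → Option G.E1} {v : G.F0} (he : IsPath e v)
    (hv : e 0 = none → v ≠ OnePoint.infty)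
    (hend : ∀ n, e n = none → ∀ A ∈ vert e v n, ¬ G.IsRegular A) :
    ∃ μ : G.Boundary, μ.edge = e ∧ μ.r = v := by
  by_cases hinf : ∀ n, e n ≠ none
  · choose p hp using fun n => Option.ne_none_iff_exists'.1 (hinf n)
    exact ⟨.infinite ⟨p, fun n => he.comp n _ _ (hp n) (hp (n + 1))⟩,
      funext fun n => (hp n).symm, (he.start _ (hp 0)).symm⟩
  · push Not at hinf
    classical
    have hn := Nat.find_spec hinf
    obtain ⟨q, hlen, hq, hr⟩ := he.exists_EStar (fun k hk => Nat.find_min hinf hk)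
      (fun h0 => hv (h0 ▸ hn))
    have hqe : q.edge = e := by
      funext k
      rcases lt_or_ge k (Nat.find hinf) with hk | hk
      · exact hq k hk
      · rw [he.none_of_le hn hk, EStar.edge_eq_none_iff, hlen]
        exact hk
    have hsg : q.d ∈ G.E0sg := by
      rw [mem_E0sg_iff, ← EStar.vert_length, hlen, hqe, hr]
      exact hend _ hn
    exact ⟨.finite q hsg, by rw [Boundary.edge_finite, hqe], by rw [Boundary.r_finite, hr]⟩

/-! ### The bijection between boundary paths and tight filters -/

theorem Boundary.pathFilter_nonempty (μ : G.Boundary) : (pathFilter μ.edge μ.r).Nonempty := by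
  suffices ∃ β A, A ∈ component (pathFilter μ.edge μ.r) β by
    obtain ⟨β, A, _, _, h⟩ := this
    exact ⟨_, h⟩
  simp only [mem_component_pathFilter]
  -- If there is an edge, its source is used, since the range could be `∞`. A path without edges is
  -- a vertex of `E⁰`.
  cases h0 : μ.edge 0 with
  | some x =>
    obtain ⟨A, hA, hAx⟩ := x.exists_mem_d
    refine ⟨[x.letter], A, hA, hasWord_concat (β := []).2 ⟨hasWord_nil, x, h0, rfl⟩, ?_⟩
    rw [List.length_singleton]
    rwa [← vert_succ_of_some (v := μ.r) h0] at hAx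
  | none =>
    cases μ with
    | infinite p => cases h0
    | finite q h =>
      rw [Boundary.edge_finite, Boundary.r_finite]
      rw [Boundary.edge_finite, EStar.edge_eq_none_iff] at h0
      obtain ⟨A, hA⟩ := q.d.2.filter.nonempty
      rw [← q.vert_length, Nat.le_zero.1 h0] at hA
      exact ⟨[], A, mem_ideal_nil A, hasWord_nil, hA⟩

/-- The tight filter of a boundary path. -/
def Boundary.toTight (μ : G.Boundary) : G.TightSpectrum :=
  ⟨pathFilter μ.edge μ.r,
    μ.isPath.isTight μ.pathFilter_nonempty fun _ hn _ hA => μ.not_isRegular hn hA⟩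

/-! ### Recovering a path from its filter -/

theorem hasWord_of_pathFilter_eq {e e' : ℕ → Option G.E1} {v v' : G.F0} (he : IsPath e v)
    (h : pathFilter e v = pathFilter e' v') {β : List L} (hβ : HasWord e β) : HasWord e' β := by
  by_cases hβ0 : β = []
  · rw [hβ0]
    exact hasWord_nil
  · obtain ⟨A, hA, hAv⟩ := he.exists_mem_vert hβ0 hβ
    have := mem_component_pathFilter.2 ⟨hA, hβ, hAv⟩
    rw [h] at this
    exact (mem_component_pathFilter.1 this).2.1

theorem vert_subset_of_pathFilter_eq {e e' : ℕ → Option G.E1} {v v' : G.F0} (he : IsPath e v)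
    (h : pathFilter e v = pathFilter e' v') {β : List L} (hβ : HasWord e β) :
    vert e v β.length ⊆ vert e' v' β.length := by
  intro D hD
  obtain ⟨w, hw⟩ := exists_E0_of_mem_vert hD
  have key : ∀ A ∈ G.ideal β, A ∈ vert e v β.length → A ∈ vert e' v' β.length := by
    intro A hA hAv
    have := mem_component_pathFilter.2 ⟨hA, hβ, hAv⟩
    rw [h] at this
    exact (mem_component_pathFilter.1 this).2.2
  by_cases hβ0 : β = []
  · subst hβ0
    exact key D (mem_ideal_nil D) hD
  -- The filter only sees elements of `I_β`, so `D` is first cut down by an element of `I_β` in the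
  -- vertex.
  · obtain ⟨A, hA, hAv⟩ := he.exists_mem_vert hβ0 hβ
    have hm : A ⊓ D ∈ vert e v β.length := by
      rw [hw] at hD hAv ⊢
      exact w.inf_mem hAv hD
    have hm' := key _ (G.ideal_lower _ inf_le_left hA) hm
    obtain ⟨w', hw'⟩ := exists_E0_of_mem_vert hm'
    rw [hw'] at hm' ⊢
    exact w'.up hm' inf_le_right

theorem exists_hasWord {e : ℕ → Option G.E1} {n : ℕ}
    (h : ∀ k < n, e k ≠ none) : ∃ β : List L, β.length = n ∧ HasWord e β := by
  induction n with
  | zero => exact ⟨[], rfl, hasWord_nil⟩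
  | succ n ih =>
    obtain ⟨β, rfl, hβ⟩ := ih fun k hk => h k (hk.trans n.lt_succ_self)
    obtain ⟨x, hx⟩ := Option.ne_none_iff_exists'.1 (h _ β.length.lt_succ_self)
    exact ⟨β ++ [x.letter], by simp, hasWord_concat.2 ⟨hβ, x, hx, rfl⟩⟩

theorem edge_eq_of_pathFilter_eq {e e' : ℕ → Option G.E1} {v v' : G.F0} (he : IsPath e v)
    (h : pathFilter e v = pathFilter e' v') {n : ℕ} {x : G.E1}
    (hx : e n = some x) : e' n = some x := by
  obtain ⟨β, hβn, hβ⟩ := exists_hasWord (n := n) fun k hk h0 => by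
    rw [he.none_of_le h0 hk.le] at hx
    cases hx
  subst hβn
  have hβx : HasWord e (β ++ [x.letter]) := hasWord_concat.2 ⟨hβ, x, hx, rfl⟩
  have hβx' := hasWord_of_pathFilter_eq he h hβx
  obtain ⟨-, y, hy, hyx⟩ := hasWord_concat.1 hβx'
  have h1 := vert_subset_of_pathFilter_eq he h hβx
  rw [List.length_append, List.length_singleton, vert_succ_of_some hx, vert_succ_of_some hy] at h1
  rw [hy, E1.ext' hyx.symm (congrArg Subtype.val (E0.eq_of_subset h1))]

theorem Boundary.toTight_injective : Function.Injective (Boundary.toTight (G := G)) := by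
  intro μ ν h
  replace h : pathFilter μ.edge μ.r = pathFilter ν.edge ν.r := congrArg Subtype.val h
  refine Boundary.ext' (funext fun n => ?_) (vset_injective ?_)
  · cases hx : μ.edge n with
    | some x => exact (edge_eq_of_pathFilter_eq μ.isPath h hx).symm
    | none =>
      cases hy : ν.edge n with
      | none => rfl
      | some y =>
        rw [edge_eq_of_pathFilter_eq ν.isPath h.symm hy] at hx
        cases hx
  · exact Subset.antisymm
      (vert_subset_of_pathFilter_eq (β := []) μ.isPath h hasWord_nil)
      (vert_subset_of_pathFilter_eq (β := []) ν.isPath h.symm hasWord_nil)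

/-! ### The path of a tight filter -/

section Surjective

variable {ξ : Set G.Semi}

/-- The ultrafilter in `B` generated by a nonempty component of a tight filter. -/
def IsTight.vertex (hξ : IsTight ξ) (β : List L) (hβ : (component ξ β).Nonempty) : G.E0 :=
  E0.ofPrime (G.cut [] (component ξ β)) (let ⟨A, hA⟩ := hβ; ⟨A, trivial, A, hA, le_rfl⟩)
    (fun ⟨_, A, hA, h⟩ => ne_bot_of_mem_component hA (le_bot_iff.1 h))
    (fun _ ⟨_, A, hA, h⟩ _ h' => ⟨trivial, A, hA, h.trans h'⟩)
    (fun _ ⟨_, A, hA, h⟩ _ ⟨_, A', hA', h'⟩ =>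
      ⟨trivial, A ⊓ A', component_inf hξ.filter hA hA', inf_le_inf h h'⟩)
    (fun D D' ⟨_, A, hA, h⟩ => by
      have : A ⊓ D ⊔ A ⊓ D' ∈ component ξ β := by rwa [← inf_sup_left, inf_eq_left.2 h]
      exact (component_sup hξ this).imp (fun h' => ⟨trivial, _, h', inf_le_right⟩)
        fun h' => ⟨trivial, _, h', inf_le_right⟩)

theorem IsTight.mem_vertex (hξ : IsTight ξ) {β : List L} {hβ : (component ξ β).Nonempty} {D : B} :
    D ∈ (hξ.vertex β hβ).1 ↔ ∃ A ∈ component ξ β, A ≤ D :=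
  ⟨fun h => h.2, fun h => ⟨trivial, h⟩⟩

theorem IsTight.mem_vertex_iff_mem_component (hξ : IsTight ξ) {β : List L}
    {hβ : (component ξ β).Nonempty} {D : B} (hD : D ∈ G.ideal β) :
    D ∈ (hξ.vertex β hβ).1 ↔ D ∈ component ξ β := by
  rw [hξ.mem_vertex]
  exact ⟨fun ⟨A, hA, h⟩ => component_up hξ.filter hA hD h, fun h => ⟨D, h, le_rfl⟩⟩

/-- The edge at the end of the word `βa` of a tight filter. -/
def IsTight.lastEdge (hξ : IsTight ξ) (β : List L) (a : L)
    (h : (component ξ (β ++ [a])).Nonempty) : G.E1 :=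
  E1.of a (hξ.vertex (β ++ [a]) h) (by
    obtain ⟨A, hA⟩ := h
    exact ⟨A, ideal_append_subset β (component_subset _ hA), hξ.mem_vertex.2 ⟨A, hA, le_rfl⟩⟩)

open Classical in
/-- The edge sequence of a tight filter. -/
noncomputable def IsTight.edge (hξ : IsTight ξ) (n : ℕ) : Option G.E1 :=
  if h : ∃ (β : List L) (a : L), β.length = n ∧ (component ξ (β ++ [a])).Nonempty then
    some (hξ.lastEdge h.choose h.choose_spec.choose h.choose_spec.choose_spec.2)
  else none

open Classical in
/-- The range of the path of a tight filter. -/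
noncomputable def IsTight.range (hξ : IsTight ξ) : G.F0 :=
  if h : (component ξ []).Nonempty then (hξ.vertex [] h : G.F0) else OnePoint.infty

theorem IsTight.exists_of_edge_eq_some (hξ : IsTight ξ) {n : ℕ} {x : G.E1}
    (hx : hξ.edge n = some x) : ∃ (β : List L) (a : L) (h : (component ξ (β ++ [a])).Nonempty),
      β.length = n ∧ x = hξ.lastEdge β a h := by
  unfold IsTight.edge at hx
  split_ifs at hx with h
  cases hx
  exact ⟨_, _, _, h.choose_spec.choose_spec.1, rfl⟩

theorem component_eq_of_length_eq (hξ : IsTight ξ) {β γ : List L}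
    (hβ : (component ξ β).Nonempty) (hγ : (component ξ γ).Nonempty) (h : β.length = γ.length) :
    β = γ := by
  rcases component_comparable hξ.filter hβ hγ with hp | hp
  · exact hp.eq_of_length h
  · exact (hp.eq_of_length h.symm).symm

/-- The choice in `IsTight.edge` is harmless: at most one word of each length has a nonempty
component. -/
theorem IsTight.edge_eq_some (hξ : IsTight ξ) {β : List L} {a : L}
    (h : (component ξ (β ++ [a])).Nonempty) : hξ.edge β.length = some (hξ.lastEdge β a h) := by
  have hex : ∃ (γ : List L) (b : L), γ.length = β.length ∧ (component ξ (γ ++ [b])).Nonempty :=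
    ⟨β, a, rfl, h⟩
  obtain ⟨x, hx⟩ : ∃ x, hξ.edge β.length = some x := ⟨_, dif_pos hex⟩
  obtain ⟨γ, b, hγ, hlen, rfl⟩ := hξ.exists_of_edge_eq_some hx
  have := component_eq_of_length_eq hξ hγ h (by simp [hlen])
  obtain ⟨rfl, hb⟩ := List.append_inj' this rfl
  cases hb
  exact hx

theorem IsTight.mem_vset_range (hξ : IsTight ξ) {D : B} :
    D ∈ vset hξ.range ↔ D ∈ component ξ [] := by
  unfold IsTight.range
  split_ifs with h
  · exact hξ.mem_vertex_iff_mem_component (mem_ideal_nil D)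
  · rw [Set.not_nonempty_iff_eq_empty.1 h]
    rfl

theorem IsTight.mem_vset_lastEdge_r (hξ : IsTight ξ) {β : List L} {a : L}
    {h : (component ξ (β ++ [a])).Nonempty} {D : B} :
    D ∈ vset (hξ.lastEdge β a h).r ↔ ∃ A ∈ component ξ (β ++ [a]), A ≤ G.θ a D := by
  rw [E1.mem_vset_r]
  simp only [IsTight.lastEdge, E1.of_letter, E1.of_d]
  exact hξ.mem_vertex

theorem IsTight.vset_lastEdge_r (hξ : IsTight ξ) {β : List L} {a : L}
    {h : (component ξ (β ++ [a])).Nonempty} (hβ : (component ξ β).Nonempty) :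
    vset (hξ.lastEdge β a h).r = (hξ.vertex β hβ).1 := by
  ext D
  rw [hξ.mem_vset_lastEdge_r, hξ.mem_vertex]
  constructor
  · rintro ⟨C, hC, hCD⟩
    obtain ⟨A, hA⟩ := hβ
    -- `D` itself need not lie in `I_β`; its meet with an element of the component does.
    refine ⟨A ⊓ D, ?_, inf_le_right⟩
    refine mem_component_of_le (ε := [a]) hξ.filter (inf_act_mem_component hξ.filter hA hC)
      (G.ideal_lower _ inf_le_left (component_subset _ hA)) ?_
    rw [act_inf]
    exact inf_le_inf_left _ hCD
  · rintro ⟨A, hA, hAD⟩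
    exact ⟨_, act_mem_component hξ.filter hA h, G.act_mono [a] hAD⟩

theorem IsTight.isPath (hξ : IsTight ξ) : IsPath hξ.edge hξ.range := by
  refine ⟨fun n hn => ?_, fun x hx => ?_, fun n x y hx hy => ?_⟩
  · by_contra hc
    obtain ⟨x, hx⟩ := Option.ne_none_iff_exists'.1 hc
    obtain ⟨β, a, h, hlen, -⟩ := hξ.exists_of_edge_eq_some hx
    obtain ⟨γ, b, rfl⟩ := List.eq_nil_or_concat' β |>.resolve_left (by rintro rfl; cases hlen)
    have h' := component_nonempty_of_append hξ.filter (by simp) h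
    have := hξ.edge_eq_some h'
    rw [List.length_append, List.length_singleton, Nat.succ_inj] at hlen
    rw [hlen, hn] at this
    cases this
  · obtain ⟨β, a, h, hlen, rfl⟩ := hξ.exists_of_edge_eq_some hx
    obtain rfl := List.eq_nil_of_length_eq_zero hlen
    refine vset_injective (Set.ext fun D => ?_)
    rw [hξ.mem_vset_range, hξ.mem_vset_lastEdge_r]
    constructor
    · exact fun hD => ⟨_, act_mem_component (ε := [a]) hξ.filter hD h, le_rfl⟩
    · rintro ⟨A, hA, hAD⟩
      exact mem_component_of_le (ε := [a]) hξ.filter hA (mem_ideal_nil D) hAD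
  · obtain ⟨β, a, h, rfl, rfl⟩ := hξ.exists_of_edge_eq_some hx
    obtain ⟨γ, b, h', hlen, rfl⟩ := hξ.exists_of_edge_eq_some hy
    have hγ : (component ξ γ).Nonempty :=
      component_nonempty_of_append hξ.filter (by rintro rfl; cases hlen) h'
    obtain rfl := component_eq_of_length_eq hξ hγ h (by simp [hlen])
    refine vset_injective ?_
    rw [hξ.vset_lastEdge_r hγ, vset_coe, IsTight.lastEdge, E1.of_d]

theorem IsTight.hasWord_of_nonempty (hξ : IsTight ξ) {β : List L}
    (h : (component ξ β).Nonempty) : HasWord hξ.edge β := by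
  induction β using List.reverseRecOn with
  | nil => exact hasWord_nil
  | append_singleton β a ih =>
    refine hasWord_concat.2 ⟨?_, _, hξ.edge_eq_some h, rfl⟩
    by_cases hβ : β = []
    · rw [hβ]
      exact hasWord_nil
    · exact ih (component_nonempty_of_append hξ.filter hβ h)

theorem IsTight.exists_component_of_hasWord (hξ : IsTight ξ) {β : List L} {x : G.E1}
    (hβ : HasWord hξ.edge β) (hx : hξ.edge β.length = some x) :
    ∃ h : (component ξ (β ++ [x.letter])).Nonempty, x = hξ.lastEdge β x.letter h := by
  obtain ⟨γ, a, h, hlen, rfl⟩ := hξ.exists_of_edge_eq_some hx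
  have hγ := (hasWord_concat.1 (hξ.hasWord_of_nonempty h)).1
  obtain rfl := (hγ.prefix_of_length_le hβ hlen.le).eq_of_length hlen
  exact ⟨h, rfl⟩

theorem IsTight.mem_vert_iff (hξ : IsTight ξ) {β : List L} (hβ : HasWord hξ.edge β) {D : B} :
    D ∈ vert hξ.edge hξ.range β.length ↔ ∃ A ∈ component ξ β, A ≤ D := by
  rcases List.eq_nil_or_concat' β with rfl | ⟨γ, a, rfl⟩
  · rw [List.length_nil, vert_zero, hξ.mem_vset_range]
    exact ⟨fun h => ⟨D, h, le_rfl⟩,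
      fun ⟨A, hA, h⟩ => component_up hξ.filter hA (mem_ideal_nil D) h⟩
  · obtain ⟨hγ, x, hx, rfl⟩ := hasWord_concat.1 hβ
    obtain ⟨h, hxl⟩ := hξ.exists_component_of_hasWord hγ hx
    rw [List.length_append, List.length_singleton, vert_succ_of_some hx, hxl]
    simp only [IsTight.lastEdge, E1.of_letter, E1.of_d]
    exact hξ.mem_vertex

theorem IsTight.pathFilter_eq (hξ : IsTight ξ) : pathFilter hξ.edge hξ.range = ξ := by
  have key : ∀ β D, D ∈ component (pathFilter hξ.edge hξ.range) β ↔ D ∈ component ξ β := by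
    intro β D
    rw [mem_component_pathFilter]
    constructor
    · rintro ⟨hD, hβ, hDv⟩
      obtain ⟨A, hA, hAD⟩ := (hξ.mem_vert_iff hβ).1 hDv
      exact component_up hξ.filter hA hD hAD
    · intro hD
      have hβ := hξ.hasWord_of_nonempty ⟨D, hD⟩
      exact ⟨component_subset _ hD, hβ, (hξ.mem_vert_iff hβ).2 ⟨D, hD, le_rfl⟩⟩
  ext s
  constructor
  · intro hs
    obtain ⟨β, A, h1, h2, rfl, -⟩ := id hs
    exact tri_mem_iff.1 hs |> (key _ _).1 |> tri_mem_iff.2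
  · intro hs
    obtain ⟨β, A, h1, h2, rfl⟩ := exists_tri_of_mem hξ.filter hs
    exact tri_mem_iff.1 hs |> (key _ _).2 |> tri_mem_iff.2

theorem Boundary.toTight_surjective : Function.Surjective (Boundary.toTight (G := G)) := by
  rintro ⟨ξ, hξ⟩
  have hp := hξ.isPath
  have hinfty : hξ.edge 0 = none → hξ.range ≠ OnePoint.infty := by
    intro h0 hv
    obtain ⟨s, hs⟩ := hξ.filter.nonempty
    rw [← hξ.pathFilter_eq] at hs
    obtain ⟨β, A, h1, h2, rfl, hβ, hA⟩ := hs
    cases β with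
    | nil =>
      rw [List.length_nil, vert_zero, hv] at hA
      exact hA
    | cons a t =>
      obtain ⟨x, hx, -⟩ := hβ 0 a rfl
      rw [h0] at hx
      cases hx
  have hend : ∀ n, hξ.edge n = none → ∀ A ∈ vert hξ.edge hξ.range n, ¬ G.IsRegular A := by
    intro n hn A hA hreg
    -- A nonempty vertex at position `n` forces the path to have its first `n` edges, which spell
    -- `β`.
    obtain ⟨β, hlen, hβ⟩ := exists_hasWord (e := hξ.edge) (n := n) fun k hk h0 => by
      obtain ⟨m, rfl⟩ := Nat.exists_eq_succ_of_ne_zero (Nat.ne_zero_of_lt hk)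
      rw [vert_succ_of_none (hp.none_of_le h0 (Nat.lt_succ_iff.1 hk))] at hA
      exact hA
    subst hlen
    -- Regularity passes to an element of the component below `A`, which forces a further edge.
    obtain ⟨C, hC, hCA⟩ := (hξ.mem_vert_iff hβ).1 hA
    obtain ⟨a, ha⟩ := component_append_nonempty_of_isRegular hξ hC (hreg.mono hCA)
    rw [hξ.edge_eq_some ha] at hn
    cases hn
  obtain ⟨μ, he, hr⟩ := hp.exists_boundary hinfty hend
  refine ⟨μ, Subtype.ext ?_⟩
  change pathFilter μ.edge μ.r = ξ
  rw [he, hr, hξ.pathFilter_eq]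

end Surjective

/-! ### The shift -/

theorem Boundary.mem_boundaryPos {μ : G.Boundary} (h : μ.edge 0 ≠ none) : μ ∈ G.boundaryPos := by
  rintro v hv rfl
  exact h rfl

theorem edge_boundaryShift (μ : G.boundaryPos) (n : ℕ) :
    (boundaryShift μ).edge n = μ.1.edge (n + 1) := by
  obtain ⟨μ | ⟨v | ⟨_ | m, p⟩, hp⟩, h⟩ := μ
  · rfl
  · exact absurd rfl (h v hp)
  · exact (FinPath.edge_of_le p (by omega)).symm
  · simp only [boundaryShift, Boundary.edge, Nat.add_lt_add_iff_right]
    rfl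

theorem r_boundaryShift (μ : G.boundaryPos) {x : G.E1} (hx : μ.1.edge 0 = some x) :
    (boundaryShift μ).r = x.d := by
  obtain ⟨μ | ⟨v | ⟨_ | m, p⟩, hp⟩, h⟩ := μ
  · cases hx
    exact (μ.2 0).symm
  · exact absurd rfl (h v hp)
  · cases hx
    rfl
  · cases hx
    exact (p.2 0).symm

/-- Dropping the first edge removes the first letter of each word (`hword`) and lowers the index of
each vertex by one (`hvert`). -/
theorem toTight_boundaryShift (μ : G.boundaryPos) (h1 : μ.1.toTight ∈ G.tightGE 1) :
    (boundaryShift μ).toTight = shift ⟨μ.1.toTight, h1⟩ := by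
  obtain ⟨x, hx⟩ : ∃ x, μ.1.edge 0 = some x := by
    obtain ⟨β, hβ, A, hA⟩ := h1
    cases β with
    | nil => cases hβ
    | cons a t =>
      obtain ⟨x, hx, -⟩ := (mem_component_pathFilter.1 hA).2.1 0 a rfl
      exact ⟨x, hx⟩
  have hword : ∀ a δ, HasWord μ.1.edge (a :: δ) ↔
      x.letter = a ∧ HasWord (boundaryShift μ).edge δ := by
    intro a δ
    constructor
    · intro h
      obtain ⟨y, hy, hya⟩ := h 0 a rfl
      rw [hx] at hy
      cases hy
      refine ⟨hya, fun i b hb => ?_⟩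
      rw [edge_boundaryShift]
      exact h (i + 1) b (by simpa using hb)
    · rintro ⟨rfl, h⟩ i b hb
      cases i with
      | zero =>
        simp only [List.getElem?_cons_zero, Option.some.injEq] at hb
        exact ⟨x, hx, hb⟩
      | succ i =>
        rw [← edge_boundaryShift]
        exact h i b (by simpa using hb)
  have hvert : ∀ n, vert (boundaryShift μ).edge (boundaryShift μ).r n =
      vert μ.1.edge μ.1.r (n + 1) := by
    intro n
    cases n with
    | zero => rw [vert_zero, r_boundaryShift μ hx, vert_succ_of_some hx, vset_coe]
    | succ n => simp only [vert, edge_boundaryShift]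
  refine Subtype.ext (Set.ext fun s => ?_)
  change s ∈ pathFilter _ _ ↔ s ∈ shiftSet (pathFilter _ _)
  constructor
  · rintro ⟨δ, D, hD0, hD, rfl, hδ, hDv⟩
    rw [hvert] at hDv
    have hw : HasWord μ.1.edge (x.letter :: δ) := (hword _ _).2 ⟨rfl, hδ⟩
    -- `D` lies in the ideal of `δ` but perhaps not in the smaller one of the longer word; meeting
    -- it with `A` provides a witness there.
    obtain ⟨A, hA, hAv⟩ := μ.1.isPath.exists_mem_vert (by simp) hw
    obtain ⟨w, hwv⟩ := exists_E0_of_mem_vert hDv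
    refine ⟨x.letter, δ, D, hD0, hD, rfl, hD, A ⊓ D,
      mem_component_pathFilter.2 ⟨G.ideal_lower _ inf_le_left hA, hw, ?_⟩, inf_le_right⟩
    rw [List.length_cons] at hAv ⊢
    rw [hwv] at hAv hDv ⊢
    exact w.inf_mem hAv hDv
  · rintro ⟨a, δ, D, hD0, hD, rfl, -, A, hA, hAD⟩
    obtain ⟨hAI, hw, hAv⟩ := mem_component_pathFilter.1 hA
    refine tri_mem_pathFilter.2 ⟨((hword a δ).1 hw).2, ?_⟩
    rw [hvert]
    rw [List.length_cons] at hAv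
    obtain ⟨w, hwv⟩ := exists_E0_of_mem_vert hAv
    rw [hwv] at hAv ⊢
    exact w.up hAv hAD

/-! ### Topology of finite paths -/

/-- The ultrafilter of all `D` with `θ_γ(D) ∈ v`. -/
def E0.pullAct (v : G.E0) (γ : List L) (h : ∃ D, G.act γ D ∈ v.1) : G.E0 :=
  E0.ofPrime {D | G.act γ D ∈ v.1} h
    (fun h => v.ne_bot (A := G.act γ ⊥) h (act_bot γ))
    (fun _ hD _ hle => v.up hD (G.act_mono γ hle))
    (fun D hD C hC => by
      rw [mem_ofPred_eq, act_inf]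
      exact v.inf_mem hD hC)
    (fun D C h => by
      rw [mem_ofPred_eq, act_sup] at h
      exact v.sup_mem h)

theorem E0.exists_mem_le (v : G.E0) {ι : Type*} (s : Finset ι) (f : ι → B) {A : B} (hA : A ∈ v.1)
    (hf : ∀ i ∈ s, f i ∈ v.1) : ∃ C ∈ v.1, C ≤ A ∧ ∀ i ∈ s, C ≤ f i := by
  classical
  induction s using Finset.induction_on with
  | empty => exact ⟨A, hA, le_rfl, by simp⟩
  | insert a s _ ih =>
    obtain ⟨C, hC, hCA, hCf⟩ := ih fun i hi => hf i (Finset.mem_insert_of_mem hi)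
    refine ⟨C ⊓ f a, v.inf_mem hC (hf a (Finset.mem_insert_self a s)), inf_le_left.trans hCA,
      fun i hi => ?_⟩
    rcases Finset.mem_insert.1 hi with rfl | hi
    · exact inf_le_right
    · exact inf_le_left.trans (hCf i hi)

variable (G) in
/-- The finite paths with word `β` whose source contains `A`. -/
def box (β : List L) (A : B) : Set G.EStar :=
  {q | q.length = β.length ∧ HasWord q.edge β ∧ A ∈ q.d.1}

theorem FinPath.mem_box_iff {n : ℕ} {p : G.FinPath n} {β : List L} {A : B} :
    (.inr ⟨n, p⟩ : G.EStar) ∈ G.box β A ↔ β.length = n + 1 ∧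
      (∀ i : Fin (n + 1), β[(i : ℕ)]? = some (p.1 i).letter) ∧ A ∈ (p.1 (Fin.last n)).d.1 := by
  constructor
  · rintro ⟨hl, hw, hA⟩
    have hl' : β.length = n + 1 := hl.symm
    refine ⟨hl', fun i => ?_, hA⟩
    have hi : (i : ℕ) < β.length := i.2.trans_eq hl'.symm
    obtain ⟨x, hx, hxa⟩ := hw i _ (List.getElem?_eq_getElem hi)
    rw [FinPath.edge_of_lt p i.2] at hx
    cases hx
    rw [List.getElem?_eq_getElem hi, ← hxa]
  · rintro ⟨hl, hw, hA⟩
    refine ⟨hl.symm, fun i a ha => ?_, hA⟩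
    have hi : i < n + 1 := hl ▸ (List.getElem?_eq_some_iff.1 ha).1
    refine ⟨_, FinPath.edge_of_lt p hi, ?_⟩
    rw [hw ⟨i, hi⟩] at ha
    exact Option.some_injective _ ha

theorem inl_mem_box_iff {v : G.E0} {β : List L} {A : B} :
    (.inl v : G.EStar) ∈ G.box β A ↔ β = [] ∧ A ∈ v.1 := by
  constructor
  · rintro ⟨hl, -, hA⟩
    exact ⟨List.eq_nil_of_length_eq_zero hl.symm, hA⟩
  · rintro ⟨rfl, hA⟩
    exact ⟨rfl, hasWord_nil, hA⟩

/-- All sources along a finite path are determined by its word and its last source. -/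
theorem FinPath.mem_d_iff {n : ℕ} (p : G.FinPath n) {β : List L} (hl : β.length = n + 1)
    (hβ : ∀ i : Fin (n + 1), β[(i : ℕ)]? = some (p.1 i).letter) (i : Fin (n + 1)) {D : B} :
    D ∈ (p.1 i).d.1 ↔ G.act (β.drop (i + 1)) D ∈ (p.1 (Fin.last n)).d.1 := by
  let q : G.EStar := .inr ⟨n, p⟩
  obtain ⟨A, hA⟩ := (p.1 (Fin.last n)).d.2.filter.nonempty
  have hw : HasWord q.edge β := (FinPath.mem_box_iff.2 ⟨hl, hβ, hA⟩).2.1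
  rw [← List.take_append_drop (i + 1) β] at hw
  have hlen : (β.take (i + 1)).length = i + 1 := by
    rw [List.length_take, hl]
    exact min_eq_left i.2
  have h := q.isPath.mem_vert_iff_act hw (D := D)
  rw [List.take_append_drop, hlen, hl] at h
  rw [vert_succ_of_some (FinPath.edge_of_lt p i.2)] at h
  rw [vert_succ_of_some (FinPath.edge_of_lt p n.lt_succ_self)] at h
  exact h

theorem isOpen_box (β : List L) (A : B) : IsOpen (G.box β A) := by
  refine isOpen_sum_iff.2 ⟨?_, isOpen_sigma_iff.2 fun n => ?_⟩
  · by_cases hβ : β = []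
    · convert isOpen_E0_mem (G := G) A using 1
      ext v
      exact inl_mem_box_iff.trans (and_iff_right hβ)
    · convert isOpen_empty using 1
      exact eq_empty_of_forall_notMem fun v hv => hβ (inl_mem_box_iff.1 hv).1
  · by_cases hβ : β.length = n + 1
    · have : Sigma.mk n ⁻¹' (Sum.inr ⁻¹' G.box β A) =
          (⋂ i : Fin (n + 1), {p : G.FinPath n | β[(i : ℕ)]? = some (p.1 i).letter}) ∩
            {p : G.FinPath n | A ∈ (p.1 (Fin.last n)).d.1} := by
        ext p
        refine FinPath.mem_box_iff.trans ((and_iff_right hβ).trans ?_)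
        simp
      rw [this]
      have hc (i : Fin (n + 1)) : Continuous fun p : G.FinPath n => p.1 i :=
        (continuous_apply i).comp continuous_subtype_val
      refine (isOpen_iInter_of_finite fun i => ?_).inter ((isOpen_E1_d A).preimage (hc _))
      have hi : (i : ℕ) < β.length := i.2.trans_eq hβ.symm
      convert (isOpen_E1_letter β[(i : ℕ)]).preimage (hc i) using 1
      ext p
      rw [mem_ofPred_eq, List.getElem?_eq_getElem hi, Option.some_inj, eq_comm]
      rfl
    · convert isOpen_empty using 1
      exact eq_empty_of_forall_notMem fun p hp => hβ (FinPath.mem_box_iff.1 hp).1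

/-- This guarantees that each vertex pulled back from `v` along a tail of `β` is the source of an
edge with the required letter. -/
theorem E0.exists_act_drop_mem {β : List L} {v : G.E0} (h : ∃ A ∈ G.ideal β, A ∈ v.1) {i : ℕ}
    (hi : i < β.length) : ∃ D ∈ G.ideal [β[i]], G.act (β.drop (i + 1)) D ∈ v.1 := by
  obtain ⟨A, hA, hAv⟩ := h
  rw [← List.take_append_drop (i + 1) β] at hA
  obtain ⟨C, hC, hAC⟩ := exists_le_act_of_mem_ideal (by
    rw [← List.take_append_getElem hi]
    exact List.concat_ne_nil _ _) hA
  rw [← List.take_append_getElem hi] at hC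
  exact ⟨C, ideal_append_subset _ hC, v.up hAv hAC⟩

/-- The path with word `β` and source `v`. -/
def FinPath.ofWord {n : ℕ} (β : List L) (hl : β.length = n + 1) (v : G.E0)
    (h : ∃ A ∈ G.ideal β, A ∈ v.1) : G.FinPath n :=
  ⟨fun i => E1.of (β[(i : ℕ)]'(i.2.trans_eq hl.symm))
      (v.pullAct (β.drop (i + 1))
        (let ⟨D, _, hD⟩ := E0.exists_act_drop_mem h (i.2.trans_eq hl.symm); ⟨D, hD⟩))
      (E0.exists_act_drop_mem h (i.2.trans_eq hl.symm)), fun i => by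
    have hi : (i : ℕ) + 1 < β.length := by have := i.2; omega
    refine vset_injective (Set.ext fun D => ?_)
    rw [E1.mem_vset_r, vset_coe]
    refine E1.mem_of_d.trans (Iff.trans ?_ E1.mem_of_d.symm)
    change G.act (β.drop (i + 1)) D ∈ v.1 ↔ G.act (β.drop (i + 1 + 1)) (G.θ β[(i : ℕ) + 1] D) ∈ v.1
    rw [List.drop_eq_getElem_cons hi, act_cons]⟩

theorem FinPath.ofWord_letter {n : ℕ} {β : List L} {hl : β.length = n + 1} {v : G.E0} {h}
    (i : Fin (n + 1)) : β[(i : ℕ)]? = some ((FinPath.ofWord β hl v h).1 i).letter :=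
  List.getElem?_eq_getElem (i.2.trans_eq hl.symm)

theorem FinPath.mem_ofWord_d {n : ℕ} {β : List L} {hl : β.length = n + 1} {v : G.E0} {h}
    {i : Fin (n + 1)} {D : B} :
    D ∈ ((FinPath.ofWord β hl v h).1 i).d.1 ↔ G.act (β.drop (i + 1)) D ∈ v.1 :=
  E1.mem_of_d (h := E0.exists_act_drop_mem h (i.2.trans_eq hl.symm))

/-- Since `A ∈ I_β`, each vertex containing `A` is the source of exactly one path with word `β`, and
this path depends continuously on the vertex. -/
theorem isCompact_box {β : List L} {A : B} (hA : A ∈ G.ideal β) : IsCompact (G.box β A) := by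
  rcases Nat.eq_zero_or_eq_succ_pred β.length with hl | hl
  · obtain rfl := List.eq_nil_of_length_eq_zero hl
    convert (isCompact_E0_mem (G := G) A).image
      (continuous_inl (Y := Σ n : ℕ, G.FinPath n)) using 1
    ext q
    rcases q with v | ⟨n, p⟩
    · rw [inl_mem_box_iff]
      simp
    · rw [FinPath.mem_box_iff]
      simp
  · set n := β.length.pred
    let f : {v : G.E0 // A ∈ v.1} → G.FinPath n :=
      fun v => FinPath.ofWord β hl v.1 ⟨A, hA, v.2⟩
    have hf : Continuous f := by
      refine Continuous.subtype_mk (continuous_pi fun i => continuous_E1_of ?_ ?_) _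
      · intro a
        change IsOpen {_v : {v : G.E0 // A ∈ v.1} | β[(i : ℕ)]'(i.2.trans_eq hl.symm) = a}
        exact isOpen_const
      · intro D
        convert (isOpen_E0_mem (G.act (β.drop (i + 1)) D)).preimage continuous_subtype_val using 1
        ext v
        exact FinPath.mem_ofWord_d (hl := hl) (h := ⟨A, hA, v.2⟩)
    have : CompactSpace {v : G.E0 // A ∈ v.1} := isCompact_iff_compactSpace.1 (isCompact_E0_mem A)
    have hg : Continuous fun v => (Sum.inr ⟨n, f v⟩ : G.EStar) :=
      continuous_inr.comp (continuous_sigmaMk.comp hf)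
    convert isCompact_range hg using 1
    ext q
    constructor
    · intro hq
      rcases q with v | ⟨m, p⟩
      · rw [(inl_mem_box_iff.1 hq).1] at hl
        cases hl
      · obtain ⟨hm, hw, hAp⟩ := FinPath.mem_box_iff.1 hq
        obtain rfl : m = n := by
          have := hm.symm.trans hl
          omega
        refine ⟨⟨_, hAp⟩, ?_⟩
        suffices f ⟨_, hAp⟩ = p from congrArg (fun p => (Sum.inr ⟨n, p⟩ : G.EStar)) this
        refine Subtype.ext (funext fun i => E1.ext' ?_ (Set.ext fun D => ?_))
        · exact Option.some_injective _ ((FinPath.ofWord_letter i).symm.trans (hw i))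
        · rw [p.mem_d_iff hm hw]
          exact FinPath.mem_ofWord_d
    · rintro ⟨v, rfl⟩
      refine FinPath.mem_box_iff.2 ⟨hl, FinPath.ofWord_letter, FinPath.mem_ofWord_d.2 ?_⟩
      rw [List.drop_eq_nil_of_le (by simp [hl])]
      exact v.2

theorem exists_box_subset {O : Set G.EStar} (hO : IsOpen O) {q : G.EStar} (hq : q ∈ O) :
    ∃ (β : List L) (A : B), A ∈ G.ideal β ∧ q ∈ G.box β A ∧ G.box β A ⊆ O := by
  obtain ⟨hl, hr⟩ := isOpen_sum_iff.1 hO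
  rcases q with v | ⟨n, p⟩
  · obtain ⟨A, hA, h⟩ := exists_mem_E0_subset hl hq
    refine ⟨[], A, mem_ideal_nil A, inl_mem_box_iff.2 ⟨rfl, hA⟩, ?_⟩
    rintro (w | ⟨m, p⟩) hm
    · exact h (inl_mem_box_iff.1 hm).2
    · cases (FinPath.mem_box_iff.1 hm).1
  · obtain ⟨W, hW, hWO⟩ := isOpen_induced_iff.1 (isOpen_sigma_iff.1 hr n)
    have hpW : p.1 ∈ W := by
      have : p ∈ Sigma.mk n ⁻¹' (Sum.inr ⁻¹' O) := hq
      rwa [← hWO] at this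
    obtain ⟨u, hu, huW⟩ := isOpen_pi_iff'.1 hW p.1 hpW
    choose A hA hAu using fun i => exists_mem_E1_subset (hu i).1 (hu i).2
    set β : List L := List.ofFn fun i => (p.1 i).letter with hβ
    have hlen : β.length = n + 1 := List.length_ofFn
    have hlet (i : Fin (n + 1)) : β[(i : ℕ)]? = some (p.1 i).letter := by
      simp only [hβ, List.getElem?_ofFn, i.2, dite_true]
    obtain ⟨A₀, hA₀, hA₀p⟩ : ∃ A ∈ G.ideal β, A ∈ (p.1 (Fin.last n)).d.1 := by
      obtain ⟨D, hD⟩ := (p.1 (Fin.last n)).d.2.filter.nonempty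
      obtain ⟨-, hw, -⟩ := FinPath.mem_box_iff.2 ⟨hlen, hlet, hD⟩
      obtain ⟨A, hA, hAv⟩ := (EStar.isPath (.inr ⟨n, p⟩ : G.EStar)).exists_mem_vert
        (List.ne_nil_of_length_pos (by omega)) hw
      rw [hlen, vert_succ_of_some (FinPath.edge_of_lt p n.lt_succ_self)] at hAv
      exact ⟨A, hA, hAv⟩
    -- The conditions on all the edges are pushed forward to the last source and met by a single
    -- `C`, kept below `A₀` to stay in `I_β`.
    obtain ⟨C, hC, hCA₀, hCA⟩ := (p.1 (Fin.last n)).d.exists_mem_le Finset.univ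
      (fun i : Fin (n + 1) => G.act (β.drop (i + 1)) (A i)) hA₀p
      fun i _ => (p.mem_d_iff hlen hlet i).1 (hA i)
    refine ⟨β, C, G.ideal_lower _ hCA₀ hA₀, FinPath.mem_box_iff.2 ⟨hlen, hlet, hC⟩, ?_⟩
    rintro (w | ⟨m, p'⟩) hm
    · rw [(inl_mem_box_iff.1 hm).1] at hlen
      cases hlen
    · obtain ⟨hlen', hlet', hC'⟩ := FinPath.mem_box_iff.1 hm
      obtain rfl : m = n := by omega
      have : p' ∈ Subtype.val ⁻¹' W := huW fun i _ => hAu i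
        ⟨Option.some_injective _ ((hlet' i).symm.trans (hlet i)),
          (p'.mem_d_iff hlen' hlet' i).2 ((p'.1 _).d.up hC' (hCA i (Finset.mem_univ i)))⟩
      exact (Set.ext_iff.1 hWO p').1 this

/-- With this `EStar` is Hausdorff, so its compact subsets are closed. -/
instance (n : ℕ) : T2Space (G.FinPath n) :=
  inferInstanceAs (T2Space {p : Fin (n + 1) → G.E1 //
    ∀ i : Fin n, ((p i.castSucc).d : G.F0) = (p i.succ).r})

/-! ### Cylinder sets -/

theorem Boundary.HasPrefix.edge_eq {μ : G.Boundary} {q : G.EStar} (h : μ.HasPrefix q) {k : ℕ}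
    (hk : k < q.length) : μ.edge k = q.edge k := by
  rcases q with v | ⟨n, p⟩
  · cases hk
  · exact (h ⟨k, hk⟩).trans (FinPath.edge_of_lt p hk).symm

theorem Boundary.HasPrefix.r_eq {μ : G.Boundary} {q : G.EStar} (h : μ.HasPrefix q) :
    μ.r = q.r := by
  rcases q with v | ⟨n, p⟩
  · exact h
  · exact μ.isPath.start _ (h 0)

theorem Boundary.hasPrefix_of {μ : G.Boundary} {q : G.EStar}
    (he : ∀ k < q.length, q.edge k = μ.edge k) (hr : q.r = μ.r) : μ.HasPrefix q := by
  rcases q with v | ⟨n, p⟩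
  · exact hr.symm
  · exact fun i => (he i i.2).symm.trans (FinPath.edge_of_lt p i.2)

theorem hasWord_congr {e e' : ℕ → Option G.E1} {β : List L}
    (h : ∀ k < β.length, e k = e' k) : HasWord e β ↔ HasWord e' β := by
  refine forall_congr' fun i => forall_congr' fun a => imp_congr_right fun ha => ?_
  rw [h i (List.getElem?_eq_some_iff.1 ha).1]

theorem vert_congr {e e' : ℕ → Option G.E1} {v : G.F0} {n : ℕ}
    (h : ∀ k < n, e k = e' k) : vert e v n = vert e' v n := by
  cases n with
  | zero => rfl
  | succ n => rw [vert, vert, h n n.lt_succ_self]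

theorem Boundary.HasPrefix.eq_of_length_eq {μ : G.Boundary} {p q : G.EStar} (hp : μ.HasPrefix p)
    (hq : μ.HasPrefix q) (h : p.length = q.length) : p = q := by
  refine EStar.ext' (funext fun k => ?_) (hp.r_eq.symm.trans hq.r_eq)
  rcases lt_or_ge k p.length with hk | hk
  · rw [← hp.edge_eq hk, hq.edge_eq (h ▸ hk)]
  · rw [EStar.edge_eq_none_iff.2 hk, EStar.edge_eq_none_iff.2 (h ▸ hk)]

theorem mem_cyl_box_iff {μ : G.Boundary} {β : List L} {A : B} :
    μ ∈ G.cyl (G.box β A) ↔ HasWord μ.edge β ∧ A ∈ vert μ.edge μ.r β.length := by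
  constructor
  · rintro ⟨q, ⟨hl, hw, hA⟩, hq⟩
    have he : ∀ k < β.length, μ.edge k = q.edge k := fun k hk => hq.edge_eq (hl ▸ hk)
    rw [hasWord_congr he, vert_congr he, hq.r_eq, ← hl, q.vert_length]
    exact ⟨hw, hA⟩
  · rintro ⟨hw, hA⟩
    obtain ⟨q, hl, he, hr⟩ := μ.isPath.exists_EStar (n := β.length) (fun k hk h0 => by
      obtain ⟨x, hx, -⟩ := hw k _ (List.getElem?_eq_getElem hk)
      rw [h0] at hx
      cases hx) (fun h0 hr => by
      rw [h0, vert_zero, hr] at hA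
      exact hA)
    refine ⟨q, ⟨hl, (hasWord_congr he).2 hw, ?_⟩, Boundary.hasPrefix_of (hl ▸ he) hr⟩
    rwa [← q.vert_length, hl, hr, vert_congr he]

/-- This matches the sets defining the topology of the tight spectrum with cylinders of boxes. -/
theorem Boundary.mem_component_toTight_iff {μ : G.Boundary} {β : List L} {A : B}
    (hA : A ∈ G.ideal β) : A ∈ component μ.toTight.1 β ↔ μ ∈ G.cyl (G.box β A) := by
  rw [mem_cyl_box_iff]
  exact mem_component_pathFilter.trans (and_iff_right hA)

theorem cyl_mono {U V : Set G.EStar} (h : U ⊆ V) : G.cyl U ⊆ G.cyl V :=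
  fun _ ⟨q, hq, hμ⟩ => ⟨q, h hq, hμ⟩

variable (G) in
theorem cyl_univ : G.cyl univ = univ := by
  refine eq_univ_of_forall fun μ => ?_
  obtain ⟨s, β, A, h1, h2, rfl, h⟩ := μ.pathFilter_nonempty
  exact cyl_mono (subset_univ _) (mem_cyl_box_iff.2 h)

/-- A box is both open and compact, so it may serve as `U` or as `K`. -/
theorem isClopen_cyl_box {β : List L} {A : B} (hA : A ∈ G.ideal β) :
    IsClopen (G.cyl (G.box β A)) := by
  refine ⟨⟨?_⟩, ?_⟩
  · refine TopologicalSpace.isOpen_generateFrom_of_mem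
      ⟨univ, G.box β A, isOpen_univ, isCompact_box hA, ?_⟩
    rw [cyl_univ, univ_inter]
  · refine TopologicalSpace.isOpen_generateFrom_of_mem
      ⟨G.box β A, ∅, isOpen_box β A, isCompact_empty, ?_⟩
    simp [cyl]

theorem Boundary.continuous_toTight : Continuous (Boundary.toTight (G := G)) := by
  refine continuous_induced_rng.2 (continuous_pi fun s => ?_)
  rw [continuous_bool_rng true]
  have : (fun μ : G.Boundary => charOf μ.toTight.1 s.1) ⁻¹' {true} =
      {μ : G.Boundary | s.1 ∈ μ.toTight.1} := by
    ext μ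
    exact charOf_eq_true
  change IsClopen ((fun μ : G.Boundary => charOf μ.toTight.1 s.1) ⁻¹' {true})
  rw [this]
  by_cases h0 : s.1 = .zero
  · have : {μ : G.Boundary | s.1 ∈ μ.toTight.1} = ∅ :=
      eq_empty_of_forall_notMem fun μ hμ => μ.toTight.2.filter.zero_notMem (h0 ▸ hμ)
    rw [this]
    exact isClopen_empty
  · obtain ⟨β, A, h1, h2, hs⟩ := Semi.eq_of_mem_idem s.2 h0
    have : {μ : G.Boundary | s.1 ∈ μ.toTight.1} = G.cyl (G.box β A) := by
      ext μ
      rw [mem_ofPred_eq, hs, tri_mem_iff, Boundary.mem_component_toTight_iff h2]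
    rw [this]
    exact isClopen_cyl_box h2

theorem isClopen_mem_component {β : List L} {A : B} (hA : A ∈ G.ideal β) :
    IsClopen {ξ : G.TightSpectrum | A ∈ component ξ.1 β} := by
  by_cases h0 : A = ⊥
  · have : {ξ : G.TightSpectrum | A ∈ component ξ.1 β} = ∅ :=
      eq_empty_of_forall_notMem fun ξ hξ => ne_bot_of_mem_component hξ h0
    rw [this]
    exact isClopen_empty
  · have hc : Continuous fun ξ : G.TightSpectrum => charOf ξ.1 (.tri β A β h0 hA hA) :=
      (continuous_apply (A := fun _ => Bool) (⟨_, Semi.tri_mem_idem h0 hA hA⟩ : G.idem)).comp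
        (continuous_induced_dom (f := fun (ξ : G.TightSpectrum) (e : G.idem) => charOf ξ.1 e.1))
    rw [continuous_bool_rng true] at hc
    convert hc using 1
    ext ξ
    exact tri_mem_iff.symm.trans charOf_eq_true.symm

variable (G) in
/-- The bijection between boundary paths and tight filters. -/
noncomputable def boundaryEquiv : G.Boundary ≃ G.TightSpectrum :=
  Equiv.ofBijective Boundary.toTight ⟨Boundary.toTight_injective, Boundary.toTight_surjective⟩

theorem preimage_cyl_box {β : List L} {A : B} (hA : A ∈ G.ideal β) :
    (boundaryEquiv G).symm ⁻¹' G.cyl (G.box β A) =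
      {ξ : G.TightSpectrum | A ∈ component ξ.1 β} := by
  ext ξ
  obtain ⟨μ, rfl⟩ := (boundaryEquiv G).surjective ξ
  rw [mem_preimage, Equiv.symm_apply_apply]
  exact (Boundary.mem_component_toTight_iff hA).symm

theorem isOpen_preimage_cyl {U : Set G.EStar} (hU : IsOpen U) :
    IsOpen ((boundaryEquiv G).symm ⁻¹' G.cyl U) := by
  rw [isOpen_iff_forall_mem_open]
  rintro ξ ⟨q, hq, hξ⟩
  obtain ⟨β, A, hA, hqA, hAU⟩ := exists_box_subset hU hq
  refine ⟨_, preimage_mono (cyl_mono hAU), ?_, q, hqA, hξ⟩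
  rw [preimage_cyl_box hA]
  exact (isClopen_mem_component hA).isOpen

/-- Finitely many boxes cover `K`. Inside a box, the cylinder of `K` is a clopen set minus the
cylinder of an open set. -/
theorem isClosed_preimage_cyl {K : Set G.EStar} (hK : IsCompact K) :
    IsClosed ((boundaryEquiv G).symm ⁻¹' G.cyl K) := by
  obtain ⟨t, ht⟩ := hK.elim_finite_subcover
    (fun i : {i : List L × B // i.2 ∈ G.ideal i.1} => G.box i.1.1 i.1.2)
    (fun i => isOpen_box _ _) (fun q _ => by
      obtain ⟨β, A, hA, hqA, -⟩ := exists_box_subset isOpen_univ (mem_univ q)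
      exact mem_iUnion.2 ⟨⟨(β, A), hA⟩, hqA⟩)
  -- A boundary path has at most one initial piece of a given length, so within one box the
  -- cylinders of `K` and of its complement are disjoint.
  have : G.cyl K = ⋃ i ∈ t, G.cyl (G.box i.1.1 i.1.2) \ G.cyl (G.box i.1.1 i.1.2 \ K) := by
    ext μ
    simp only [mem_iUnion, exists_prop, mem_sdiff]
    constructor
    · rintro ⟨q, hq, hμ⟩
      obtain ⟨i, hi, hqi⟩ := mem_iUnion₂.1 (ht hq)
      refine ⟨i, hi, ⟨q, hqi, hμ⟩, ?_⟩
      rintro ⟨q', ⟨hq', hq'K⟩, hμ'⟩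
      rw [hμ'.eq_of_length_eq hμ (hq'.1.trans hqi.1.symm)] at hq'K
      exact hq'K hq
    · rintro ⟨i, hi, ⟨q, hq, hμ⟩, hn⟩
      by_contra hc
      exact hn ⟨q, ⟨hq, fun hqK => hc ⟨q, hqK, hμ⟩⟩, hμ⟩
  rw [this, preimage_iUnion₂]
  refine isClosed_biUnion_finset fun i _ => ?_
  rw [preimage_sdiff, preimage_cyl_box i.2]
  exact (isClopen_mem_component i.2).isClosed.sdiff
    (isOpen_preimage_cyl ((isOpen_box _ _).sdiff hK.isClosed))

variable (G) in
/-- The homeomorphism between the tight spectrum and the boundary path space. -/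
noncomputable def tightHomeo : G.TightSpectrum ≃ₜ G.Boundary where
  toEquiv := (boundaryEquiv G).symm
  continuous_toFun := by
    refine continuous_generateFrom_iff.2 ?_
    rintro _ ⟨U, K, hU, hK, rfl⟩
    exact (isOpen_preimage_cyl hU).inter (isClosed_preimage_cyl hK).isOpen_compl
  continuous_invFun := Boundary.continuous_toTight

end GBDS

theorem theorem7 {B L : Type*} [GeneralizedBooleanAlgebra B] (G : GBDS B L) :
    ∃ φ : G.TightSpectrum ≃ₜ G.Boundary,
      ∀ ξ : G.tightGE 1, ∃ h : φ ξ.1 ∈ G.boundaryPos,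
        φ (GBDS.shift ξ) = GBDS.boundaryShift ⟨φ ξ.1, h⟩ := by
  refine ⟨G.tightHomeo, ?_⟩
  rintro ⟨ξ, hξ⟩
  obtain ⟨μ, rfl⟩ := (GBDS.boundaryEquiv G).surjective ξ
  have hμ : G.tightHomeo (GBDS.boundaryEquiv G μ) = μ := Equiv.symm_apply_apply _ μ
  have h0 : μ ∈ G.boundaryPos := by
    -- A nonempty component at a word of positive length provides a first edge.
    refine GBDS.Boundary.mem_boundaryPos fun h0 => ?_
    obtain ⟨β, hβ, A, hA⟩ := hξ
    cases β with
    | nil => cases hβ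
    | cons a t =>
      obtain ⟨x, hx, -⟩ := (GBDS.mem_component_pathFilter.1 hA).2.1 0 a rfl
      rw [h0] at hx
      cases hx
  refine ⟨by rwa [hμ], ?_⟩
  have h1 : (GBDS.boundaryShift ⟨μ, h0⟩).toTight = GBDS.shift ⟨_, hξ⟩ :=
    GBDS.toTight_boundaryShift ⟨μ, h0⟩ hξ
  simp only [hμ]
  rw [← h1]
  exact Equiv.symm_apply_apply (GBDS.boundaryEquiv G) _
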